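/- **Setting.** Fix a set of propositional connectives, each with a finite arity, among them a designated constant $e$ and a designated binary connective $\otimes$, and let the quantifier symbols be $\{\forall,\exists\}$. A (many-sorted) signature $Sg$ consists of sorts, function symbols $f:\sigma_1,\dots,\sigma_n\to\tau$ and relation symbols $R\subseteq\sigma_1,\dots,\sigma_n$. A context is a finite list $\Gamma=x_1:\sigma_1,\dots,x_n:\sigma_n$ of distinct sorted variables. Terms-in-context $M:\tau\,[\Gamma]$ are built from the variables of $\Gamma$ and function symbols; formulas-in-context $\phi\,[\Gamma]$ are built from $R(M_1,\dots,M_n)$ and $M=_\sigma N$ by connectives and by quantification ($\Omega_{x:\sigma}\phi\,[\Gamma]$ from $\phi\,[\Gamma,x:\sigma]$, $\Omega\in\{\forall,\exists\}$). Expressions are taken up to renaming of variables. An assertion is an equation $M=N:\tau\,[\Gamma]$ or a sequent $\phi_1,\dots,\phi_n\vdash\psi\,[\Gamma]$, $n\ge 0$; an $Sg$-theory is a set of $Sg$-assertions. **Logics.** All logics contain equational logic: reflexivity, symmetry, transitivity, and, from $M=M':\sigma\,[\Delta]$ and $N=N':\tau\,[\Gamma,x:\sigma,\Gamma']$, the equation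 $N[M/x]=N'[M'/x]:\tau\,[\Gamma,\Gamma']$, where the variables of $\Delta$ are among those of $\Gamma,\Gamma'$. The minimal logic $\mathcal L^m$ has in addition the rules (a double line $\Longleftrightarrow$ stands for both directions): - Ax: $\phi\vdash\phi\,[\Gamma]$. Cut: from $\phi\vdash\psi\,[\Gamma]$ and $\psi\vdash\theta\,[\Gamma]$ infer $\phi\vdash\theta\,[\Gamma]$. - Cwk: from $\Phi\vdash\psi\,[\Gamma]$ infer $\Phi\vdash\psi\,[\Gamma,x:\sigma]$. - Sub: from $M=M':\sigma\,[\Delta]$ and $\Phi\vdash\psi\,[\Gamma,x:\sigma,\Gamma']$ infer $\Phi[M/x]\vdash\psi[M'/x]\,[\Gamma,\Gamma']$, where the variables of $\Delta$ are among those of $\Gamma,\Gamma'$. - $\Omega$-Con: from $\phi\vdash\psi$ and $\psi\vdash\phi\,[\Gamma,x:\sigma]$ infer $\Omega_{x:\sigma}\phi\vdash\Omega_{x:\sigma}\psi\,[\Gamma]$, for $\Omega\in\{\forall,\exists\}$. - $\Diamond$-Cong: from $\phi_i\vdash\phi_i'$ and $\phi_i'\vdash\phi_i\,[\Gamma]$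 for all $i\le n$ infer $\Diamond(\phi_1,\dots,\phi_n)\vdash\Diamond(\phi_1',\dots,\phi_n')\,[\Gamma]$, for every $n$-ary connective $\Diamond$. - $\otimes$-Ref: $\Phi,\alpha,\beta,\Psi\vdash\theta\,[\Gamma]\Longleftrightarrow\Phi,\alpha\otimes\beta,\Psi\vdash\theta\,[\Gamma]$. $e$-Ref: $\Phi,e,\Psi\vdash\theta\,[\Gamma]\Longleftrightarrow\Phi,\Psi\vdash\theta\,[\Gamma]$. The adjoint rules are - $=$-Adj: $\Phi\vdash\psi[x/x']\,[\Gamma,x:\sigma]\Longleftrightarrow\Phi,\,x=_\sigma x'\vdash\psi\,[\Gamma,x:\sigma,x':\sigma]$, with $\Phi$ in context $\Gamma,x:\sigma$; - $\exists$-Adj: $\Phi,\psi\vdash\theta\,[\Gamma,x:\sigma]\Longleftrightarrow\Phi,\exists_{x:\sigma}\psi\vdash\theta\,[\Gamma]$, with $\Phi,\theta$ in context $\Gamma$; - $\forall$-Adj: $\Phi\vdash\psi\,[\Gamma,x:\sigma]\Longleftrightarrow\Phi\vdash\forall_{x:\sigma}\psi\,[\Gamma]$, with $\Phi$ in context $\Gamma$.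 A *propositional connective rule* is a schema with finitely many premises and one conclusion, all of them sequents in one common arbitrary context $\Gamma$, whose succedents are meta-formulas (built from formula metavariables by connectives only) and whose antecedents are finite lists of meta-formulas and of metavariables for finite lists of formulas; it is *structural* if no connective occurs in it. Let $\mathcal L$ be the extension of $\mathcal L^m$ by any selection of the three adjoint rules and any set of structural and propositional connective rules. $T_{\mathcal L}$ is the set of assertions derivable from $T$; $T\vdash_{\mathcal L}T'$ means $T'\subseteq T_{\mathcal L}$; $T$ is an $\mathcal L$-theory if $T=T_{\mathcal L}$. **Semantics.** An object $(\mathcal C,P)$ of $\mathbf{FA}$ is a category $\mathcal C$ with designated finite products and a functor $P:\mathcal C^{op}\to\mathbf{Pos}$ such that: (1) each $P(c)$ is an algebra for the connectives, and each $P(f)$ is a homomorphism; (2) there are designated elements $Eq_c\in P(c\times c)$; (3) for $\Omega\in\{\forall,\exists\}$ there are maps $\Omega_{b,c}:P(b\times c)\to P(b)$, natural in $b$; (4) $(P(c),\otimes,e)$ is a monoid; (5) $\Omega_{b,1}\circ P(\pi_1)=\mathrm{id}$ and $\Omega_{b,c\times d}\circ P(a_{b,c,d})=\Omega_{b,c}\circ\Omega_{b\times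 c,d}$, where $a_{b,c,d}:b\times(c\times d)\cong(b\times c)\times d$; (6) $Eq_1=e_{1\times1}$, and $Eq_{c_1\times c_2}=P(\langle\pi_1p_1,\pi_1p_2\rangle)Eq_{c_1}\otimes P(\langle\pi_2p_1,\pi_2p_2\rangle)Eq_{c_2}$, where $p_1,p_2$ are the projections of $(c_1\times c_2)^2$. An $Sg$-structure $S$ in $(\mathcal C,P)$ assigns objects to sorts, morphisms $[\![\sigma_1]\!]\times\cdots\times[\![\sigma_n]\!]\to[\![\tau]\!]$ to function symbols and elements of $P([\![\sigma_1]\!]\times\cdots\times[\![\sigma_n]\!])$ to relation symbols, and interprets terms, formulas, connectives, $=_\sigma$ (by $Eq$) and quantifiers (by $\Omega_{[\![\Gamma]\!],[\![\sigma]\!]}$) in the usual recursive way. It satisfies $M=N:\tau\,[\Gamma]$ if $[\![M]\!]=[\![N]\!]$, and $\phi_1,\dots,\phi_n\vdash\psi\,[\Gamma]$ if $[\![\phi_1]\!]\otimes\cdots\otimes[\![\phi_n]\!]\le[\![\psi]\!]$ (with $e$ on the left if $n=0$); it is a $T$-model if it satisfies all assertions of $T$. For a class $\mathcal K$ of such objects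 and $Sg$-theories $T,T'$, $T\vDash_{\mathcal K}T'$ means that every $T$-model in every member of $\mathcal K$ is a $T'$-model. For an $\mathcal L$-theory $T$, the classifying prop-category $(\mathcal C_T,P_T)\in\mathbf{FA}$ has as objects the contexts, as morphisms $\Gamma'\to\Gamma$ the tuples of terms in context $\Gamma'$ of the sorts of $\Gamma$, modulo $T$-provable equality, with composition by substitution and products by concatenation. $P_T(\Gamma)$ is the set of formulas-in-context $\phi\,[\Gamma]$ modulo $\phi\dashv\vdash\psi\,[\Gamma]\in T$, ordered by $\phi\vdash\psi\,[\Gamma]\in T$, and $P_T$ acts on morphisms by substitution. Connectives act on representatives; $\Omega_{\Gamma,\Gamma'}(\phi)=\Omega_{y_1:\tau_1}\cdots\Omega_{y_m:\tau_m}\phi$ for $\Gamma'=y_1:\tau_1,\dots,y_m:\tau_m$; and $Eq_\Gamma$ is the class of $x_1=_{\sigma_1}x_1'\otimes\cdots\otimes x_n=_{\sigma_n}x_n'$ (of $e$ if $n=0$). **Theorem.** Let $\mathcal L$ be such a logic and $\mathcal K=\{(\mathcal C_T,P_T): T\text{ is an }\mathcal L\text{-theory over some signature}\}$. Then $\vdash_{\mathcal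 L}\;=\;\vDash_{\mathcal K}$: for every signature $Sg$ and all $Sg$-theories $T,T'$, $T\vdash_{\mathcal L}T'$ if and only if $T\vDash_{\mathcal K}T'$. -/

import Mathlib

universe u v

namespace FibLogic

open CategoryTheory MonoidalCategory CartesianMonoidalCategory Opposite

/-! ## First-order languages, signatures, terms and formulas in context -/

/-- The propositional part of a first-order language: the connectives of each arity, with a
designated constant `e` and a designated binary connective `⊗`. -/
structure Language where
  Conn : ℕ → Type v
  unit : Conn 0
  tensor : Conn 2

/-- The quantifier symbols. -/
inductive Quantifier where
  | all
  | ex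

/-- A many-sorted signature; `dom f` and `ar R` list the argument sorts of a function symbol `f`
and of a relation symbol `R`. -/
structure Signature where
  Srt : Type u
  Fn : Type u
  dom : Fn → List Srt
  cod : Fn → Srt
  Rel : Type u
  ar : Rel → List Srt

/-- `Var Γ σ` is the type of variables of sort `σ` declared in the context `Γ`. A context is the
list of the sorts of its variables, the most recently declared variable being the head: the
context `[Γ, x : σ]` is `σ :: Γ`, and `[Γ, Γ']` is `Γ' ++ Γ`. Expressions in context are thus
represented up to renaming of free and bound variables (de Bruijn indices). -/
inductive Var {S : Type u} : List S → S → Type u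
  | zero {Γ : List S} {σ : S} : Var (σ :: Γ) σ
  | succ {Γ : List S} {σ τ : S} : Var Γ σ → Var (τ :: Γ) σ

/-- Combine families indexed by the variables of `Γ'` and of `Γ` into one indexed by those of
`[Γ, Γ']`. -/
def Var.append {S : Type u} {F : S → Type u} : {Γ' Γ : List S} →
    (∀ ⦃σ⦄, Var Γ' σ → F σ) → (∀ ⦃σ⦄, Var Γ σ → F σ) → ∀ ⦃σ⦄, Var (Γ' ++ Γ) σ → F σ
  | [], _, _, t, _, v => t v
  | _ :: _, _, s, _, _, .zero => s .zero
  | _ :: _, _, s, t, _, .succ v => Var.append (fun _ w => s w.succ) t v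

/-- Extend a family indexed by the variables of `Γ` to one indexed by those of `[Γ, x : τ]`. -/
def Var.cons {S : Type u} {F : S → Type u} {Γ : List S} {τ : S} (a : F τ)
    (t : ∀ ⦃σ⦄, Var Γ σ → F σ) : ∀ ⦃σ⦄, Var (τ :: Γ) σ → F σ
  | _, .zero => a
  | _, .succ v => t v

/-- Type-preserving maps of variables. -/
abbrev Ren {S : Type u} (Γ Δ : List S) : Type u := ∀ ⦃σ : S⦄, Var Γ σ → Var Δ σ

/-- The variables of `Γ` inside `[Γ, Γ']`. -/
def Var.inr {S : Type u} {Γ : List S} : (Γ' : List S) → Ren Γ (Γ' ++ Γ)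
  | [], _, v => v
  | _ :: Γ', _, v => (Var.inr Γ' v).succ

/-- The variables of `Γ'` inside `[Γ, Γ']`. -/
def Var.inl {S : Type u} : {Γ' : List S} → (Γ : List S) → Ren Γ' (Γ' ++ Γ)
  | _ :: _, _, _, .zero => .zero
  | _ :: _, Γ, _, .succ v => (Var.inl Γ v).succ

/-- Terms in context, `M : τ [Γ]`. The arguments of a function symbol are indexed by the
positions of its list of argument sorts. -/
inductive Term (Sg : Signature.{u}) (Γ : List Sg.Srt) : Sg.Srt → Type u
  | var {σ : Sg.Srt} : Var Γ σ → Term Sg Γ σ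
  | app (f : Sg.Fn) : (∀ ⦃σ⦄, Var (Sg.dom f) σ → Term Sg Γ σ) → Term Sg Γ (Sg.cod f)

/-- `Subst Γ Δ`: a term in context `Δ` for every variable of `Γ`. -/
abbrev Subst {Sg : Signature.{u}} (Γ Δ : List Sg.Srt) : Type u :=
  ∀ ⦃σ : Sg.Srt⦄, Var Γ σ → Term Sg Δ σ

variable {𝓛 : Language.{v}} {Sg : Signature.{u}}

/-- Simultaneous substitution in terms. -/
def Term.subst {Γ Δ : List Sg.Srt} (s : Subst Γ Δ) {τ : Sg.Srt} : Term Sg Γ τ → Term Sg Δ τ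
  | .var v => s v
  | .app f M => .app f fun _ v => (M v).subst s

/-- Regard a map of variables as a substitution. -/
def Ren.sub {Γ Δ : List Sg.Srt} (ρ : Ren Γ Δ) : Subst Γ Δ := fun _ v => .var (ρ v)

/-- The substitution that regards an expression over `Γ` as one over `[Γ, x : σ]`. -/
def Subst.wk {Γ : List Sg.Srt} (σ : Sg.Srt) : Subst Γ (σ :: Γ) := Ren.sub fun _ v => v.succ

/-- The identity substitution. -/
def Subst.id (Γ : List Sg.Srt) : Subst Γ Γ := fun _ v => .var v

/-- Composition of substitutions. -/
def Subst.comp {Γ Δ Ξ : List Sg.Srt} (s : Subst Γ Δ) (t : Subst Δ Ξ) : Subst Γ Ξ :=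
  fun _ v => (s v).subst t

/-- Extend a substitution to one fresh variable. -/
def Subst.lift {Γ Δ : List Sg.Srt} (σ : Sg.Srt) (s : Subst Γ Δ) : Subst (σ :: Γ) (σ :: Δ) :=
  Var.cons (.var .zero) fun _ v => (s v).subst (Subst.wk σ)

/-- The substitution `[M/x]` from `[Γ, x : σ, Γ']` to `[Γ, Γ']`. -/
def Subst.single (Γ Γ' : List Sg.Srt) {σ : Sg.Srt} (M : Term Sg (Γ' ++ Γ) σ) :
    Subst (Γ' ++ σ :: Γ) (Γ' ++ Γ) :=
  Var.append (Ren.sub (Var.inl Γ)) (Var.cons M (Ren.sub (Var.inr Γ')))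

/-- Formulas in context, `φ : prop [Γ]`. -/
inductive Formula (𝓛 : Language.{v}) (Sg : Signature.{u}) : List Sg.Srt → Type (max u v)
  | rel {Γ : List Sg.Srt} (R : Sg.Rel) : Subst (Sg.ar R) Γ → Formula 𝓛 Sg Γ
  | eq {Γ : List Sg.Srt} {σ : Sg.Srt} : Term Sg Γ σ → Term Sg Γ σ → Formula 𝓛 Sg Γ
  | conn {Γ : List Sg.Srt} {n : ℕ} : 𝓛.Conn n → (Fin n → Formula 𝓛 Sg Γ) → Formula 𝓛 Sg Γ
  | quant {Γ : List Sg.Srt} (q : Quantifier) (σ : Sg.Srt) :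
      Formula 𝓛 Sg (σ :: Γ) → Formula 𝓛 Sg Γ

/-- Simultaneous (capture-avoiding) substitution in formulas. -/
def Formula.subst {Γ Δ : List Sg.Srt} : Formula 𝓛 Sg Γ → Subst Γ Δ → Formula 𝓛 Sg Δ
  | .rel R M, s => .rel R (M.comp s)
  | .eq M N, s => .eq (M.subst s) (N.subst s)
  | .conn c φ, s => .conn c fun i => (φ i).subst s
  | .quant q σ φ, s => .quant q σ (φ.subst (s.lift σ))

/-- The constant `e` as a formula. -/
def Formula.unit {Γ : List Sg.Srt} : Formula 𝓛 Sg Γ := .conn 𝓛.unit ![]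

/-- The formula `φ ⊗ ψ`. -/
def Formula.tensor {Γ : List Sg.Srt} (φ ψ : Formula 𝓛 Sg Γ) : Formula 𝓛 Sg Γ :=
  .conn 𝓛.tensor ![φ, ψ]

/-- Assertions: equations-in-context `M = N : τ [Γ]` and sequents-in-context `Φ ⊢ ψ [Γ]`. -/
inductive Assertion (𝓛 : Language.{v}) (Sg : Signature.{u}) : Type (max u v)
  | eqn {Γ : List Sg.Srt} {τ : Sg.Srt} (M N : Term Sg Γ τ)
  | seq {Γ : List Sg.Srt} (Φ : List (Formula 𝓛 Sg Γ)) (ψ : Formula 𝓛 Sg Γ)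

/-- An `Sg`-theory is a collection of `Sg`-assertions. -/
abbrev Theory (𝓛 : Language.{v}) (Sg : Signature.{u}) : Type (max u v) := Set (Assertion 𝓛 Sg)

/-! ## Derivation rules

A rule is given by its instances: `R P a` says that `a` may be inferred from the set `P`. -/

/-- The rules of equational logic. In the substitution rule the equation `M = M'` lives in a
context `Δ` whose variables occur among those of `[Γ, Γ']`, which is expressed by an injective
type-preserving map of variables. -/
inductive EqRule : Set (Assertion 𝓛 Sg) → Assertion 𝓛 Sg → Prop
  | refl {Γ : List Sg.Srt} {τ : Sg.Srt} (M : Term Sg Γ τ) : EqRule ∅ (.eqn M M)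
  | symm {Γ : List Sg.Srt} {τ : Sg.Srt} (M N : Term Sg Γ τ) : EqRule {.eqn M N} (.eqn N M)
  | trans {Γ : List Sg.Srt} {τ : Sg.Srt} (M N K : Term Sg Γ τ) :
      EqRule {.eqn M N, .eqn N K} (.eqn M K)
  | sub {Γ Γ' Δ : List Sg.Srt} {σ τ : Sg.Srt} (ρ : Ren Δ (Γ' ++ Γ))
      (hρ : ∀ σ, Function.Injective (@ρ σ)) (M M' : Term Sg Δ σ)
      (N N' : Term Sg (Γ' ++ σ :: Γ) τ) :
      EqRule {.eqn M M', .eqn N N'}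
        (.eqn (N.subst (Subst.single Γ Γ' (M.subst (Ren.sub ρ))))
          (N'.subst (Subst.single Γ Γ' (M'.subst (Ren.sub ρ)))))

/-- The sequent rules of the minimal logic `𝓛ᵐ`. -/
inductive MinRule : Set (Assertion 𝓛 Sg) → Assertion 𝓛 Sg → Prop
  | ax {Γ : List Sg.Srt} (φ : Formula 𝓛 Sg Γ) : MinRule ∅ (.seq [φ] φ)
  | cut {Γ : List Sg.Srt} (φ ψ θ : Formula 𝓛 Sg Γ) :
      MinRule {.seq [φ] ψ, .seq [ψ] θ} (.seq [φ] θ)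
  | cwk {Γ : List Sg.Srt} (σ : Sg.Srt) (Φ : List (Formula 𝓛 Sg Γ)) (ψ : Formula 𝓛 Sg Γ) :
      MinRule {.seq Φ ψ} (.seq (Φ.map (·.subst (Subst.wk σ))) (ψ.subst (Subst.wk σ)))
  | sub {Γ Γ' Δ : List Sg.Srt} {σ : Sg.Srt} (ρ : Ren Δ (Γ' ++ Γ))
      (hρ : ∀ σ, Function.Injective (@ρ σ)) (M M' : Term Sg Δ σ)
      (Φ : List (Formula 𝓛 Sg (Γ' ++ σ :: Γ))) (ψ : Formula 𝓛 Sg (Γ' ++ σ :: Γ)) :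
      MinRule {.eqn M M', .seq Φ ψ}
        (.seq (Φ.map (·.subst (Subst.single Γ Γ' (M.subst (Ren.sub ρ)))))
          (ψ.subst (Subst.single Γ Γ' (M'.subst (Ren.sub ρ)))))
  | quant_con {Γ : List Sg.Srt} (q : Quantifier) (σ : Sg.Srt) (φ ψ : Formula 𝓛 Sg (σ :: Γ)) :
      MinRule {.seq [φ] ψ, .seq [ψ] φ} (.seq [.quant q σ φ] (.quant q σ ψ))
  | conn_cong {Γ : List Sg.Srt} {n : ℕ} (c : 𝓛.Conn n) (φ ψ : Fin n → Formula 𝓛 Sg Γ) :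
      MinRule {a | ∃ i, a = .seq [φ i] (ψ i) ∨ a = .seq [ψ i] (φ i)}
        (.seq [.conn c φ] (.conn c ψ))
  | tensor_down {Γ : List Sg.Srt} (Φ Ψ : List (Formula 𝓛 Sg Γ)) (α β θ : Formula 𝓛 Sg Γ) :
      MinRule {.seq (Φ ++ α :: β :: Ψ) θ} (.seq (Φ ++ α.tensor β :: Ψ) θ)
  | tensor_up {Γ : List Sg.Srt} (Φ Ψ : List (Formula 𝓛 Sg Γ)) (α β θ : Formula 𝓛 Sg Γ) :
      MinRule {.seq (Φ ++ α.tensor β :: Ψ) θ} (.seq (Φ ++ α :: β :: Ψ) θ)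
  | unit_down {Γ : List Sg.Srt} (Φ Ψ : List (Formula 𝓛 Sg Γ)) (θ : Formula 𝓛 Sg Γ) :
      MinRule {.seq (Φ ++ Formula.unit :: Ψ) θ} (.seq (Φ ++ Ψ) θ)
  | unit_up {Γ : List Sg.Srt} (Φ Ψ : List (Formula 𝓛 Sg Γ)) (θ : Formula 𝓛 Sg Γ) :
      MinRule {.seq (Φ ++ Ψ) θ} (.seq (Φ ++ Formula.unit :: Ψ) θ)

/-- The two directions of the rule `=`-Adj, with `ψ` in the context `[Γ, x : σ, x' : σ]` and `Φ`
in the context `[Γ, x : σ]`. -/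
inductive EqAdj : Set (Assertion 𝓛 Sg) → Assertion 𝓛 Sg → Prop
  | down {Γ : List Sg.Srt} {σ : Sg.Srt} (Φ : List (Formula 𝓛 Sg (σ :: Γ)))
      (ψ : Formula 𝓛 Sg (σ :: σ :: Γ)) :
      EqAdj {.seq Φ (ψ.subst (Subst.single (σ :: Γ) [] (.var .zero)))}
        (.seq (Φ.map (·.subst (Subst.wk σ)) ++ [.eq (.var (.succ .zero)) (.var .zero)]) ψ)
  | up {Γ : List Sg.Srt} {σ : Sg.Srt} (Φ : List (Formula 𝓛 Sg (σ :: Γ)))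
      (ψ : Formula 𝓛 Sg (σ :: σ :: Γ)) :
      EqAdj {.seq (Φ.map (·.subst (Subst.wk σ)) ++ [.eq (.var (.succ .zero)) (.var .zero)]) ψ}
        (.seq Φ (ψ.subst (Subst.single (σ :: Γ) [] (.var .zero))))

/-- The two directions of the rule `∃`-Adj. -/
inductive ExAdj : Set (Assertion 𝓛 Sg) → Assertion 𝓛 Sg → Prop
  | down {Γ : List Sg.Srt} {σ : Sg.Srt} (Φ : List (Formula 𝓛 Sg Γ))
      (ψ : Formula 𝓛 Sg (σ :: Γ)) (θ : Formula 𝓛 Sg Γ) :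
      ExAdj {.seq (Φ.map (·.subst (Subst.wk σ)) ++ [ψ]) (θ.subst (Subst.wk σ))}
        (.seq (Φ ++ [.quant .ex σ ψ]) θ)
  | up {Γ : List Sg.Srt} {σ : Sg.Srt} (Φ : List (Formula 𝓛 Sg Γ))
      (ψ : Formula 𝓛 Sg (σ :: Γ)) (θ : Formula 𝓛 Sg Γ) :
      ExAdj {.seq (Φ ++ [.quant .ex σ ψ]) θ}
        (.seq (Φ.map (·.subst (Subst.wk σ)) ++ [ψ]) (θ.subst (Subst.wk σ)))

/-- The two directions of the rule `∀`-Adj. -/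
inductive AllAdj : Set (Assertion 𝓛 Sg) → Assertion 𝓛 Sg → Prop
  | down {Γ : List Sg.Srt} {σ : Sg.Srt} (Φ : List (Formula 𝓛 Sg Γ))
      (ψ : Formula 𝓛 Sg (σ :: Γ)) :
      AllAdj {.seq (Φ.map (·.subst (Subst.wk σ))) ψ} (.seq Φ (.quant .all σ ψ))
  | up {Γ : List Sg.Srt} {σ : Sg.Srt} (Φ : List (Formula 𝓛 Sg Γ))
      (ψ : Formula 𝓛 Sg (σ :: Γ)) :
      AllAdj {.seq Φ (.quant .all σ ψ)} (.seq (Φ.map (·.subst (Subst.wk σ))) ψ)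

/-! ### Structural and propositional connective rules -/

/-- Meta-formulas: built from formula metavariables by propositional connectives. -/
inductive MetaFormula (𝓛 : Language.{v}) : Type v
  | var : ℕ → MetaFormula 𝓛
  | conn {n : ℕ} : 𝓛.Conn n → (Fin n → MetaFormula 𝓛) → MetaFormula 𝓛

/-- An item of an antecedent: a meta-formula, or a metavariable for a finite list of formulas. -/
inductive MetaItem (𝓛 : Language.{v}) : Type v
  | formula : MetaFormula 𝓛 → MetaItem 𝓛
  | list : ℕ → MetaItem 𝓛

/-- Meta-sequents. -/
structure MetaSequent (𝓛 : Language.{v}) : Type v where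
  antecedent : List (MetaItem 𝓛)
  succedent : MetaFormula 𝓛

/-- A propositional connective rule: finitely many premises and a conclusion, all in one and the
same arbitrary context. A structural rule is one in which no connective occurs. -/
structure PropRule (𝓛 : Language.{v}) : Type v where
  premises : List (MetaSequent 𝓛)
  conclusion : MetaSequent 𝓛

/-- The value of a meta-formula under an assignment of formulas to the metavariables. -/
def MetaFormula.inst {Γ : List Sg.Srt} (φ : ℕ → Formula 𝓛 Sg Γ) :
    MetaFormula 𝓛 → Formula 𝓛 Sg Γ
  | .var i => φ i
  | .conn c m => .conn c fun i => (m i).inst φ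

/-- The list of formulas that an item of an antecedent stands for. -/
def MetaItem.inst {Γ : List Sg.Srt} (φ : ℕ → Formula 𝓛 Sg Γ)
    (Φ : ℕ → List (Formula 𝓛 Sg Γ)) : MetaItem 𝓛 → List (Formula 𝓛 Sg Γ)
  | .formula m => [m.inst φ]
  | .list i => Φ i

/-- The sequent that a meta-sequent stands for. -/
def MetaSequent.inst {Γ : List Sg.Srt} (φ : ℕ → Formula 𝓛 Sg Γ)
    (Φ : ℕ → List (Formula 𝓛 Sg Γ)) (s : MetaSequent 𝓛) : Assertion 𝓛 Sg :=
  .seq (s.antecedent.flatMap (·.inst φ Φ)) (s.succedent.inst φ)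

/-- An extension of the minimal logic: which of the three adjoint rules are added, and which
structural and propositional connective rules. -/
structure Logic (𝓛 : Language.{v}) : Type v where
  eqAdj : Prop
  exAdj : Prop
  allAdj : Prop
  rules : Set (PropRule 𝓛)

/-- The rules common to all the logics considered: equational logic and the rules of `𝓛ᵐ`. -/
inductive BaseRule : Set (Assertion 𝓛 Sg) → Assertion 𝓛 Sg → Prop
  | eq {P : Set (Assertion 𝓛 Sg)} {a : Assertion 𝓛 Sg} : EqRule P a → BaseRule P a
  | min {P : Set (Assertion 𝓛 Sg)} {a : Assertion 𝓛 Sg} : MinRule P a → BaseRule P a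

/-- The instances of the rules of a logic. -/
inductive Logic.Rule (L : Logic 𝓛) : Set (Assertion 𝓛 Sg) → Assertion 𝓛 Sg → Prop
  | base {P : Set (Assertion 𝓛 Sg)} {a : Assertion 𝓛 Sg} : BaseRule P a → Logic.Rule L P a
  | eqAdj {P : Set (Assertion 𝓛 Sg)} {a : Assertion 𝓛 Sg} :
      L.eqAdj → EqAdj P a → Logic.Rule L P a
  | exAdj {P : Set (Assertion 𝓛 Sg)} {a : Assertion 𝓛 Sg} :
      L.exAdj → ExAdj P a → Logic.Rule L P a
  | allAdj {P : Set (Assertion 𝓛 Sg)} {a : Assertion 𝓛 Sg} :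
      L.allAdj → AllAdj P a → Logic.Rule L P a
  | prop {r : PropRule 𝓛} (hr : r ∈ L.rules) {Γ : List Sg.Srt} (φ : ℕ → Formula 𝓛 Sg Γ)
      (Φ : ℕ → List (Formula 𝓛 Sg Γ)) :
      Logic.Rule L {a | ∃ s ∈ r.premises, a = s.inst φ Φ} (r.conclusion.inst φ Φ)

/-- Derivability of an assertion from a theory. -/
inductive Logic.Derivable (L : Logic 𝓛) (T : Theory 𝓛 Sg) : Assertion 𝓛 Sg → Prop
  | hyp {a : Assertion 𝓛 Sg} : a ∈ T → Logic.Derivable L T a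
  | infer {P : Set (Assertion 𝓛 Sg)} {a : Assertion 𝓛 Sg} :
      L.Rule P a → (∀ b ∈ P, Logic.Derivable L T b) → Logic.Derivable L T a

/-- The `L`-closure of a theory. -/
def Logic.closure (L : Logic 𝓛) (T : Theory 𝓛 Sg) : Theory 𝓛 Sg := {a | L.Derivable T a}

/-- `T ⊢_L T'`. -/
def Logic.Entails (L : Logic 𝓛) (T T' : Theory 𝓛 Sg) : Prop := T' ⊆ L.closure T

/-- `T` is an `L`-theory if it is equal to its `L`-closure. -/
def Logic.IsTheory (L : Logic 𝓛) (T : Theory 𝓛 Sg) : Prop := L.closure T = T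

/-! ## Prop-categories and their semantics -/

/-- The objects of `FA`: prop-categories (a category with designated finite products and a
contravariant functor to posets) with connectives, equality and quantifiers. -/
structure PropCat (𝓛 : Language.{v}) where
  C : Type u
  [cat : Category.{u} C]
  [prod : CartesianMonoidalCategory C]
  P : Cᵒᵖ ⥤ PartOrd.{max u v}
  conn : ∀ (c : C) {n : ℕ}, 𝓛.Conn n → (Fin n → P.obj (op c)) → P.obj (op c)
  conn_map : ∀ {b c : C} (f : b ⟶ c) {n : ℕ} (d : 𝓛.Conn n) (x : Fin n → P.obj (op c)),
    P.map f.op (conn c d x) = conn b d fun i => P.map f.op (x i)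
  eq : ∀ c : C, P.obj (op (c ⊗ c))
  quant : Quantifier → ∀ b c : C, P.obj (op (b ⊗ c)) → P.obj (op b)
  quant_nat : ∀ (q : Quantifier) {a b : C} (f : a ⟶ b) (c : C) (x : P.obj (op (b ⊗ c))),
    P.map f.op (quant q b c x) = quant q a c (P.map (f ▷ c).op x)
  tensor_assoc : ∀ (c : C) (x y z : P.obj (op c)),
    conn c 𝓛.tensor ![conn c 𝓛.tensor ![x, y], z] = conn c 𝓛.tensor ![x, conn c 𝓛.tensor ![y, z]]
  unit_tensor : ∀ (c : C) (x : P.obj (op c)), conn c 𝓛.tensor ![conn c 𝓛.unit ![], x] = x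
  tensor_unit : ∀ (c : C) (x : P.obj (op c)), conn c 𝓛.tensor ![x, conn c 𝓛.unit ![]] = x
  quant_one : ∀ (q : Quantifier) (b : C) (x : P.obj (op b)),
    quant q b (𝟙_ C) (P.map (fst b (𝟙_ C)).op x) = x
  quant_prod : ∀ (q : Quantifier) (b c d : C) (x : P.obj (op ((b ⊗ c) ⊗ d))),
    quant q b (c ⊗ d) (P.map (α_ b c d).inv.op x) = quant q b c (quant q (b ⊗ c) d x)
  eq_one : eq (𝟙_ C) = conn (𝟙_ C ⊗ 𝟙_ C) 𝓛.unit ![]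
  eq_prod : ∀ c₁ c₂ : C, eq (c₁ ⊗ c₂) =
    conn ((c₁ ⊗ c₂) ⊗ (c₁ ⊗ c₂)) 𝓛.tensor
      ![P.map (lift (fst (c₁ ⊗ c₂) (c₁ ⊗ c₂) ≫ fst c₁ c₂)
          (snd (c₁ ⊗ c₂) (c₁ ⊗ c₂) ≫ fst c₁ c₂)).op (eq c₁),
        P.map (lift (fst (c₁ ⊗ c₂) (c₁ ⊗ c₂) ≫ snd c₁ c₂)
          (snd (c₁ ⊗ c₂) (c₁ ⊗ c₂) ≫ snd c₁ c₂)).op (eq c₂)]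

attribute [instance] PropCat.cat PropCat.prod

/-- The designated product `1 × ⟦σ₁⟧ × ⋯ × ⟦σₙ⟧` associated with a context. -/
def PropCat.ctx (A : PropCat.{u, v} 𝓛) {S : Type u} (o : S → A.C) : List S → A.C
  | [] => 𝟙_ A.C
  | σ :: Γ => A.ctx o Γ ⊗ o σ

/-- The projections of the product associated with a context. -/
def PropCat.proj (A : PropCat.{u, v} 𝓛) {S : Type u} (o : S → A.C) : {Γ : List S} → {σ : S} →
    Var Γ σ → (A.ctx o Γ ⟶ o σ)
  | _, _, .zero => snd _ _
  | _, _, .succ v => fst _ _ ≫ A.proj o v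

/-- Tupling of morphisms into the product associated with a context. -/
def PropCat.tuple (A : PropCat.{u, v} 𝓛) {S : Type u} (o : S → A.C) {X : A.C} :
    {Γ : List S} → (∀ ⦃σ⦄, Var Γ σ → (X ⟶ o σ)) → (X ⟶ A.ctx o Γ)
  | [], _ => toUnit X
  | _ :: _, s => lift (A.tuple o fun _ v => s v.succ) (s .zero)

/-- An `Sg`-structure in a prop-category. -/
structure Str (Sg : Signature.{u}) (A : PropCat.{u, v} 𝓛) where
  srt : Sg.Srt → A.C
  fn : ∀ f : Sg.Fn, A.ctx srt (Sg.dom f) ⟶ srt (Sg.cod f)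
  rel : ∀ R : Sg.Rel, A.P.obj (op (A.ctx srt (Sg.ar R)))

/-- Interpretation of terms in context. -/
def Str.term {A : PropCat.{u, v} 𝓛} (S : Str Sg A) {Γ : List Sg.Srt} {τ : Sg.Srt} :
    Term Sg Γ τ → (A.ctx S.srt Γ ⟶ S.srt τ)
  | .var v => A.proj S.srt v
  | .app f M => A.tuple S.srt (fun _ v => S.term (M v)) ≫ S.fn f

/-- Interpretation of formulas in context. -/
def Str.formula {A : PropCat.{u, v} 𝓛} (S : Str Sg A) {Γ : List Sg.Srt} :
    Formula 𝓛 Sg Γ → A.P.obj (op (A.ctx S.srt Γ))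
  | .rel R M => A.P.map (A.tuple S.srt fun _ v => S.term (M v)).op (S.rel R)
  | .eq (σ := σ) M N => A.P.map (lift (S.term M) (S.term N)).op (A.eq (S.srt σ))
  | .conn c φ => A.conn _ c fun i => S.formula (φ i)
  | .quant q σ φ => A.quant q _ (S.srt σ) (S.formula φ)

/-- The product `x₁ ⊗ ⋯ ⊗ xₙ` in `P(c)`, equal to `e` if `n = 0`. -/
def PropCat.tensorList (A : PropCat.{u, v} 𝓛) (c : A.C) (l : List (A.P.obj (op c))) :
    A.P.obj (op c) :=
  l.foldr (fun x y => A.conn c 𝓛.tensor ![x, y]) (A.conn c 𝓛.unit ![])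

/-- Satisfaction of an assertion by a structure. -/
def Str.Sat {A : PropCat.{u, v} 𝓛} (S : Str Sg A) : Assertion 𝓛 Sg → Prop
  | .eqn M N => S.term M = S.term N
  | .seq Φ ψ => A.tensorList _ (Φ.map S.formula) ≤ S.formula ψ

/-- The theory of a structure. -/
def Str.theory {A : PropCat.{u, v} 𝓛} (S : Str Sg A) : Theory 𝓛 Sg := {a | S.Sat a}

/-- `S` is a `T`-model. -/
def Str.IsModel {A : PropCat.{u, v} 𝓛} (S : Str Sg A) (T : Theory 𝓛 Sg) : Prop := T ⊆ S.theory

/-- Semantic consequence `T ⊨_𝒳 T'` over a class `𝒳` of prop-categories. -/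
def Models (𝒳 : Set (PropCat.{u, v} 𝓛)) (T T' : Theory 𝓛 Sg) : Prop :=
  ∀ A ∈ 𝒳, ∀ S : Str Sg A, S.IsModel T → S.IsModel T'

/-! ## Substitution lemmas -/

lemma Term.subst_id {Γ : List Sg.Srt} {τ : Sg.Srt} (M : Term Sg Γ τ) :
    M.subst (Subst.id Γ) = M := by
  induction M with
  | var v => rfl
  | app f M ih => simp only [Term.subst, ih]

lemma Term.subst_comp {Γ Δ Ξ : List Sg.Srt} (s : Subst Γ Δ) (t : Subst Δ Ξ) {τ : Sg.Srt}
    (M : Term Sg Γ τ) : (M.subst s).subst t = M.subst (s.comp t) := by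
  induction M with
  | var v => rfl
  | app f M ih => simp only [Term.subst, ih]

lemma Subst.comp_assoc {Γ Δ Ξ Θ : List Sg.Srt} (s : Subst Γ Δ) (t : Subst Δ Ξ)
    (r : Subst Ξ Θ) : (s.comp t).comp r = s.comp (t.comp r) := by
  funext σ v; exact Term.subst_comp t r (s v)

lemma Subst.comp_id {Γ Δ : List Sg.Srt} (s : Subst Γ Δ) : s.comp (Subst.id Δ) = s := by
  funext σ v; exact Term.subst_id (s v)

lemma Subst.id_comp {Γ Δ : List Sg.Srt} (s : Subst Γ Δ) : (Subst.id Γ).comp s = s := rfl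

lemma Subst.lift_id (Γ : List Sg.Srt) (σ : Sg.Srt) :
    (Subst.id Γ).lift σ = Subst.id (σ :: Γ) := by
  funext τ v; cases v <;> rfl

lemma Subst.lift_comp {Γ Δ Ξ : List Sg.Srt} (σ : Sg.Srt) (s : Subst Γ Δ) (t : Subst Δ Ξ) :
    (s.lift σ).comp (t.lift σ) = (s.comp t).lift σ := by
  funext τ v
  cases v with
  | zero => rfl
  | succ v =>
    change ((s v).subst (Subst.wk σ)).subst (t.lift σ) = ((s v).subst t).subst (Subst.wk σ)
    rw [Term.subst_comp, Term.subst_comp]; rfl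

lemma Formula.subst_id {Γ : List Sg.Srt} (φ : Formula 𝓛 Sg Γ) : φ.subst (Subst.id Γ) = φ := by
  induction φ with
  | rel R M => simp only [Formula.subst, Subst.comp_id]
  | eq M N => simp only [Formula.subst, Term.subst_id]
  | conn c φ ih => simp only [Formula.subst, ih]
  | quant q σ φ ih => simp only [Formula.subst, Subst.lift_id, ih]

lemma Formula.subst_comp {Γ Δ Ξ : List Sg.Srt} (s : Subst Γ Δ) (t : Subst Δ Ξ)
    (φ : Formula 𝓛 Sg Γ) : (φ.subst s).subst t = φ.subst (s.comp t) := by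
  induction φ generalizing Δ Ξ with
  | rel R M => simp only [Formula.subst, Subst.comp_assoc]
  | eq M N => simp only [Formula.subst, Term.subst_comp]
  | conn c φ ih => simp only [Formula.subst, ih]
  | quant q σ φ ih => simp only [Formula.subst, ih, Subst.lift_comp]

lemma Var.append_inl {S : Type u} {F : S → Type u} {Γ' Γ : List S}
    (s : ∀ ⦃σ⦄, Var Γ' σ → F σ) (t : ∀ ⦃σ⦄, Var Γ σ → F σ) {σ : S} (v : Var Γ' σ) :
    Var.append s t (Var.inl Γ v) = s v := by
  induction v with
  | zero => rfl
  | succ v ih => exact ih fun _ w => s w.succ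

lemma Var.append_inr {S : Type u} {F : S → Type u} {Γ' Γ : List S}
    (s : ∀ ⦃σ⦄, Var Γ' σ → F σ) (t : ∀ ⦃σ⦄, Var Γ σ → F σ) {σ : S} (v : Var Γ σ) :
    Var.append s t (Var.inr Γ' v) = t v := by
  induction Γ' with
  | nil => rfl
  | cons τ Γ' ih => exact ih fun _ w => s w.succ

lemma Var.append_eta {S : Type u} {F : S → Type u} {Γ' Γ : List S}
    (r : ∀ ⦃σ⦄, Var (Γ' ++ Γ) σ → F σ) :
    Var.append (fun _ v => r (Var.inl Γ v)) (fun _ v => r (Var.inr Γ' v)) = r := by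
  induction Γ' with
  | nil => rfl
  | cons τ Γ' ih =>
    funext σ v
    cases v with
    | zero => rfl
    | succ v => exact congrFun (congrFun (ih fun _ w => r w.succ) σ) v

lemma Var.append_ext {S : Type u} {F : S → Type u} {Γ' Γ : List S}
    {r r' : ∀ ⦃σ⦄, Var (Γ' ++ Γ) σ → F σ}
    (h₁ : ∀ σ (v : Var Γ' σ), r (Var.inl Γ v) = r' (Var.inl Γ v))
    (h₂ : ∀ σ (v : Var Γ σ), r (Var.inr Γ' v) = r' (Var.inr Γ' v)) : r = r' := by
  rw [← Var.append_eta r, ← Var.append_eta r']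
  congr 1 <;> funext σ v
  · exact h₁ σ v
  · exact h₂ σ v

lemma Var.inl_injective {S : Type u} (Γ' Γ : List S) (σ : S) :
    Function.Injective (@Var.inl S Γ' Γ σ) := by
  intro v w h
  have := congrArg (fun x => Var.append (F := fun σ => Var Γ' σ ⊕ Var Γ σ)
    (fun _ a => Sum.inl a) (fun _ a => Sum.inr a) x) h
  simpa [Var.append_inl] using this

lemma Subst.append_comp {Γ' Γ Δ Ξ : List Sg.Srt} (s : Subst Γ' Δ) (t : Subst Γ Δ)
    (r : Subst Δ Ξ) : Subst.comp (Var.append s t) r = Var.append (s.comp r) (t.comp r) := by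
  apply Var.append_ext <;> intro σ v
  · simp only [Subst.comp, Var.append_inl]
  · simp only [Subst.comp, Var.append_inr]

/-! ## Theories closed under the base rules -/

/-- Closure under the rules of equational logic and of `𝓛ᵐ`. -/
def IsBaseTheory (T : Theory 𝓛 Sg) : Prop :=
  ∀ (P : Set (Assertion 𝓛 Sg)) (a : Assertion 𝓛 Sg), BaseRule P a → P ⊆ T → a ∈ T

lemma Logic.IsTheory.base {L : Logic 𝓛} {T : Theory 𝓛 Sg} (hT : L.IsTheory T) :
    IsBaseTheory T := by
  intro P a h hP
  rw [← hT]
  exact .infer (.base h) fun b hb => .hyp (hP hb)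

lemma Subst.inl_single {Γ Γ' Δ : List Sg.Srt} {σ : Sg.Srt} (s : Subst Γ' Δ) (t : Subst Γ Δ)
    (M : Term Sg (Γ' ++ Γ) σ) :
    (Subst.single Γ Γ' M).comp (Var.append s t) =
      Var.append s (Var.cons (M.subst (Var.append s t)) t) := by
  rw [Subst.single, Subst.append_comp]
  apply Var.append_ext <;> intro τ v
  · simp only [Var.append_inl, Subst.comp, Ren.sub, Term.subst]
  · simp only [Var.append_inr, Subst.comp]
    cases v with
    | zero => rfl
    | succ v => simp only [Var.cons, Ren.sub, Term.subst, Var.append_inr]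

lemma Var.cons_eta {S : Type u} {F : S → Type u} {Γ : List S} {τ : S}
    (t : ∀ ⦃σ⦄, Var (τ :: Γ) σ → F σ) :
    Var.cons (t .zero) (fun _ v => t v.succ) = t := by
  funext σ v; cases v <;> rfl

lemma IsBaseTheory.refl {T : Theory 𝓛 Sg} (hT : IsBaseTheory T) {Γ : List Sg.Srt} {τ : Sg.Srt}
    (M : Term Sg Γ τ) : .eqn M M ∈ T :=
  hT _ _ (.eq (.refl M)) (by simp)

lemma IsBaseTheory.symm {T : Theory 𝓛 Sg} (hT : IsBaseTheory T) {Γ : List Sg.Srt} {τ : Sg.Srt}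
    {M N : Term Sg Γ τ} (h : .eqn M N ∈ T) : .eqn N M ∈ T :=
  hT _ _ (.eq (.symm M N)) (by simpa using h)

lemma IsBaseTheory.trans {T : Theory 𝓛 Sg} (hT : IsBaseTheory T) {Γ : List Sg.Srt} {τ : Sg.Srt}
    {M N K : Term Sg Γ τ} (h : .eqn M N ∈ T) (h' : .eqn N K ∈ T) : .eqn M K ∈ T :=
  hT _ _ (.eq (.trans M N K)) (by rintro _ (rfl | rfl) <;> assumption)

/-- Weakening of equations to a longer context, here obtained from the substitution rule. -/
lemma IsBaseTheory.wk_eqn {T : Theory 𝓛 Sg} (hT : IsBaseTheory T) {Γ Δ : List Sg.Srt}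
    {τ : Sg.Srt} {M N : Term Sg Γ τ} (ρ : Ren Γ Δ) (hρ : ∀ σ, Function.Injective (@ρ σ))
    (h : .eqn M N ∈ T) : .eqn (M.subst (Ren.sub ρ)) (N.subst (Ren.sub ρ)) ∈ T :=
  hT _ _ (.eq (.sub (Γ := Δ) (Γ' := []) ρ hρ M N (.var .zero) (.var .zero)))
    (by rintro _ (rfl | rfl); exacts [h, hT.refl _])

lemma Var.inl_nil {S : Type u} {Γ : List S} {σ : S} (w : Var Γ σ) : HEq (Var.inl [] w) w := by
  induction w with
  | zero => simp only [Var.inl]; congr 1; simp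
  | succ w ih => simp only [Var.inl]; congr 1; simp

/-- A property of expressions over `[Γ, Δ]` that is inherited under single substitutions of
`T`-equal terms passes to simultaneous substitution. -/
lemma IsBaseTheory.simul {X : List Sg.Srt → Type (max u v)}
    (sub : ∀ {Γ Δ : List Sg.Srt}, X Γ → Subst Γ Δ → X Δ)
    (sub_id : ∀ {Γ : List Sg.Srt} (x : X Γ), sub x (Subst.id Γ) = x)
    (sub_comp : ∀ {Γ Δ Ξ : List Sg.Srt} (s : Subst Γ Δ) (t : Subst Δ Ξ) (x : X Γ),
      sub (sub x s) t = sub x (s.comp t))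
    {T : Theory 𝓛 Sg} (R : ∀ {Γ : List Sg.Srt}, X Γ → X Γ → Prop)
    (single : ∀ {Γ Γ' Δ : List Sg.Srt} {σ : Sg.Srt} (ρ : Ren Δ (Γ' ++ Γ))
      (_ : ∀ σ, Function.Injective (@ρ σ)) (M M' : Term Sg Δ σ) (x x' : X (Γ' ++ σ :: Γ)),
      .eqn M M' ∈ T → R x x' → R (sub x (Subst.single Γ Γ' (M.subst (Ren.sub ρ))))
        (sub x' (Subst.single Γ Γ' (M'.subst (Ren.sub ρ)))))
    {Δ : List Sg.Srt} : ∀ {Γ : List Sg.Srt} (x x' : X (Δ ++ Γ)) (s s' : Subst Γ Δ),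
      (∀ σ (v : Var Γ σ), .eqn (s v) (s' v) ∈ T) → R x x' →
      R (sub x (Var.append (Subst.id Δ) s)) (sub x' (Var.append (Subst.id Δ) s'))
  | [], x, x', s, s', _, h => by
    have key : ∀ (Ξ : List Sg.Srt) (_ : Ξ = Δ) (r r' : Subst Ξ Δ) (y y' : X Ξ),
        (∀ (σ : Sg.Srt) (v : Var Ξ σ) (w : Var Δ σ), HEq v w → r v = .var w ∧ r' v = .var w) →
        R y y' → R (sub y r) (sub y' r') := by
      intro Ξ e r r' y y' hr hy
      subst e
      obtain rfl : r = Subst.id Ξ := by funext σ v; exact (hr σ v v HEq.rfl).1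
      obtain rfl : r' = Subst.id Ξ := by funext σ v; exact (hr σ v v HEq.rfl).2
      rwa [sub_id, sub_id]
    refine key _ (List.append_nil Δ) _ _ x x' ?_ h
    intro σ v w hvw
    have : v = Var.inl [] w := eq_of_heq (hvw.trans (Var.inl_nil w).symm)
    subst this
    exact ⟨Var.append_inl _ _ w, Var.append_inl _ _ w⟩
  | σ :: Γ, x, x', s, s', hs, h => by
    have h1 := single (Γ := Γ) (Γ' := Δ) (fun _ v => Var.inl Γ v)
      (fun τ => Var.inl_injective Δ Γ τ) (s .zero) (s' .zero) x x' (hs _ _) h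
    have h2 := simul sub sub_id sub_comp R single _ _ (fun _ v => s v.succ)
      (fun _ v => s' v.succ) (fun _ v => hs _ _) h1
    have e : ∀ s : Subst (σ :: Γ) Δ,
        (Subst.single Γ Δ ((s .zero).subst (Ren.sub fun _ v => Var.inl Γ v))).comp
          (Var.append (Subst.id Δ) fun _ v => s v.succ) = Var.append (Subst.id Δ) s := by
      intro s
      rw [Subst.inl_single, Term.subst_comp]
      congr 1
      conv_rhs => rw [← Var.cons_eta s]
      congr 1
      conv_rhs => rw [← Term.subst_id (s .zero)]
      congr 1
      funext τ v
      exact Var.append_inl _ _ v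
    rw [sub_comp, sub_comp, e, e] at h2
    exact h2

lemma Subst.inr_append {Γ Δ : List Sg.Srt} (s : Subst Γ Δ) :
    Subst.comp (Ren.sub (Var.inr Δ)) (Var.append (Subst.id Δ) s) = s := by
  funext σ v; exact Var.append_inr _ _ v

/-- Simultaneous substitution in equations. -/
lemma IsBaseTheory.subst_eqn {T : Theory 𝓛 Sg} (hT : IsBaseTheory T) {Γ Δ : List Sg.Srt}
    {s s' : Subst Γ Δ} (hs : ∀ σ (v : Var Γ σ), .eqn (s v) (s' v) ∈ T) {τ : Sg.Srt}
    {M N : Term Sg Γ τ} (h : .eqn M N ∈ T) : .eqn (M.subst s) (N.subst s') ∈ T := by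
  have h1 : .eqn (M.subst (Ren.sub (Var.inr Δ))) (N.subst (Ren.sub (Var.inr Δ))) ∈ T := by
    refine hT.wk_eqn _ ?_ h
    intro σ v w hvw
    have := congrArg (fun x => Var.append (F := fun σ => Var Δ σ ⊕ Var Γ σ)
      (fun _ a => Sum.inl a) (fun _ a => Sum.inr a) x) hvw
    simpa [Var.append_inr] using this
  have h2 := IsBaseTheory.simul (X := fun Γ => ULift.{v} (Term Sg Γ τ))
    (fun x s => ⟨x.down.subst s⟩) (fun x => by simp [Term.subst_id])
    (fun s t x => by simp [Term.subst_comp]) (T := T) (fun x y => .eqn x.down y.down ∈ T)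
    (fun ρ hρ M M' x x' h h' => hT _ _ (.eq (.sub ρ hρ M M' x.down x'.down))
      (by rintro _ (rfl | rfl) <;> assumption)) ⟨_⟩ ⟨_⟩ s s' hs h1
  simpa only [Term.subst_comp, Subst.inr_append] using h2

/-- Simultaneous substitution in sequents. -/
lemma IsBaseTheory.subst_seq {T : Theory 𝓛 Sg} (hT : IsBaseTheory T) {Γ Δ : List Sg.Srt}
    {s s' : Subst Γ Δ} (hs : ∀ σ (v : Var Γ σ), .eqn (s v) (s' v) ∈ T)
    {φ ψ : Formula 𝓛 Sg Γ} (h : .seq [φ] ψ ∈ T) : .seq [φ.subst s] (ψ.subst s') ∈ T := by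
  have h1 : .seq [φ.subst (Ren.sub (Var.inr Δ))] (ψ.subst (Ren.sub (Var.inr Δ))) ∈ T := by
    clear hs s s'
    induction Δ with
    | nil =>
      change .seq [φ.subst (Subst.id Γ)] (ψ.subst (Subst.id Γ)) ∈ T
      rwa [Formula.subst_id, Formula.subst_id]
    | cons σ Δ ih =>
      have := hT _ _ (.min (.cwk σ _ _)) (Set.singleton_subset_iff.2 ih)
      simp only [List.map, Formula.subst_comp] at this
      exact this
  have h2 := IsBaseTheory.simul (X := fun Γ => Formula 𝓛 Sg Γ) Formula.subst Formula.subst_id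
    Formula.subst_comp (T := T) (fun x y => .seq [x] y ∈ T)
    (fun ρ hρ M M' x x' h h' => hT _ _ (.min (.sub ρ hρ M M' [x] x'))
      (by rintro _ (rfl | rfl) <;> assumption)) _ _ s s' hs h1
  simpa only [Formula.subst_comp, Subst.inr_append] using h2

/-! ## The classifying prop-category of a theory -/

/-- `T`-equality of tuples of terms. -/
def IsBaseTheory.substSetoid {T : Theory 𝓛 Sg} (hT : IsBaseTheory T) (Γ Δ : List Sg.Srt) :
    Setoid (Subst Γ Δ) where
  r s s' := ∀ (σ : Sg.Srt) (v : Var Γ σ), .eqn (s v) (s' v) ∈ T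
  iseqv :=
    { refl := fun s σ v => hT.refl (s v)
      symm := fun h σ v => hT.symm (h σ v)
      trans := fun h h' σ v => hT.trans (h σ v) (h' σ v) }

/-- `φ ∼ ψ` if `φ ⊢ ψ` and `ψ ⊢ φ` belong to `T`. -/
def IsBaseTheory.formulaSetoid {T : Theory 𝓛 Sg} (hT : IsBaseTheory T) (Γ : List Sg.Srt) :
    Setoid (Formula 𝓛 Sg Γ) where
  r φ ψ := .seq [φ] ψ ∈ T ∧ .seq [ψ] φ ∈ T
  iseqv :=
    { refl := fun φ => ⟨hT _ _ (.min (.ax φ)) (by simp), hT _ _ (.min (.ax φ)) (by simp)⟩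
      symm := fun h => ⟨h.2, h.1⟩
      trans := fun h h' =>
        ⟨hT _ _ (.min (.cut _ _ _)) (by rintro _ (rfl | rfl); exacts [h.1, h'.1]),
          hT _ _ (.min (.cut _ _ _)) (by rintro _ (rfl | rfl); exacts [h'.2, h.2])⟩ }

/-- The objects of the classifying category: contexts up to renaming of variables. -/
structure Cls {T : Theory 𝓛 Sg} (hT : IsBaseTheory T) : Type u where
  of ::
  ctx : List Sg.Srt

/-- The elements of the poset over a context: formulas in context modulo `∼`. -/
def FormCls {T : Theory 𝓛 Sg} (hT : IsBaseTheory T) (Γ : List Sg.Srt) : Type (max u v) :=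
  Quotient (hT.formulaSetoid Γ)

/-- The class of a formula. -/
def FormCls.mk {T : Theory 𝓛 Sg} (hT : IsBaseTheory T) {Γ : List Sg.Srt}
    (φ : Formula 𝓛 Sg Γ) : FormCls hT Γ := Quotient.mk _ φ

lemma FormCls.mk_eq {T : Theory 𝓛 Sg} (hT : IsBaseTheory T) {Γ : List Sg.Srt}
    {φ ψ : Formula 𝓛 Sg Γ} :
    FormCls.mk hT φ = FormCls.mk hT ψ ↔ .seq [φ] ψ ∈ T ∧ .seq [ψ] φ ∈ T :=
  Quotient.eq

lemma FormCls.exists_mk {T : Theory 𝓛 Sg} {hT : IsBaseTheory T} {Γ : List Sg.Srt}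
    (x : FormCls hT Γ) : ∃ φ, FormCls.mk hT φ = x := Quotient.exists_rep x

/-- `φ/∼ ≤ ψ/∼` if `φ ⊢ ψ` belongs to `T`. -/
instance FormCls.partialOrder {T : Theory 𝓛 Sg} (hT : IsBaseTheory T) (Γ : List Sg.Srt) :
    PartialOrder (FormCls hT Γ) where
  le := Quotient.lift₂ (fun φ ψ => .seq [φ] ψ ∈ T) (by
    intro φ ψ φ' ψ' h h'
    refine propext ⟨fun k => ?_, fun k => ?_⟩
    · have k1 := hT _ _ (.min (.cut φ' φ ψ)) (by rintro _ (rfl | rfl); exacts [h.2, k])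
      exact hT _ _ (.min (.cut φ' ψ ψ')) (by rintro _ (rfl | rfl); exacts [k1, h'.1])
    · have k1 := hT _ _ (.min (.cut φ φ' ψ')) (by rintro _ (rfl | rfl); exacts [h.1, k])
      exact hT _ _ (.min (.cut φ ψ' ψ)) (by rintro _ (rfl | rfl); exacts [k1, h'.2]))
  le_refl x := by
    obtain ⟨φ, rfl⟩ := x.exists_mk
    exact hT _ _ (.min (.ax φ)) (by simp)
  le_trans x y z h h' := by
    obtain ⟨φ, rfl⟩ := x.exists_mk
    obtain ⟨ψ, rfl⟩ := y.exists_mk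
    obtain ⟨θ, rfl⟩ := z.exists_mk
    exact hT _ _ (.min (.cut φ ψ θ)) (by rintro _ (rfl | rfl); exacts [h, h'])
  le_antisymm x y h h' := by
    obtain ⟨φ, rfl⟩ := x.exists_mk
    obtain ⟨ψ, rfl⟩ := y.exists_mk
    exact (FormCls.mk_eq hT).2 ⟨h, h'⟩

/-- Morphisms `Δ ⟶ Γ` are tuples of terms in context `Δ`, one for each variable of `Γ`, modulo
`T`-equality; composition is substitution. -/
instance Cls.category {T : Theory 𝓛 Sg} (hT : IsBaseTheory T) : Category.{u} (Cls hT) where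
  Hom Δ Γ := Quotient (hT.substSetoid Γ.ctx Δ.ctx)
  id Γ := Quotient.mk _ (Subst.id Γ.ctx)
  comp f g := Quotient.map₂ (fun s t => t.comp s)
    (fun _ _ hs t t' (ht : ∀ σ v, Assertion.eqn (t v) (t' v) ∈ T) σ v =>
      hT.subst_eqn hs (ht σ v)) f g
  id_comp f := by
    induction f using Quotient.inductionOn with
    | _ s => exact congrArg (Quotient.mk _) (Subst.comp_id s)
  comp_id f := by
    induction f using Quotient.inductionOn with
    | _ s => exact congrArg (Quotient.mk _) (Subst.id_comp s)
  assoc f g h := by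
    induction f using Quotient.inductionOn with
    | _ s =>
    induction g using Quotient.inductionOn with
    | _ t =>
    induction h using Quotient.inductionOn with
    | _ r => exact congrArg (Quotient.mk _) (Subst.comp_assoc r t s).symm

/-- The type of morphisms `Δ ⟶ Γ` of the classifying category. -/
abbrev Cls.Hom {T : Theory 𝓛 Sg} (hT : IsBaseTheory T) (Δ Γ : List Sg.Srt) : Type u :=
  (⟨Δ⟩ : Cls hT) ⟶ (⟨Γ⟩ : Cls hT)

/-- The morphism given by a tuple of terms. -/
def Cls.homMk {T : Theory 𝓛 Sg} (hT : IsBaseTheory T) {Γ Δ : List Sg.Srt} (s : Subst Γ Δ) :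
    Cls.Hom hT Δ Γ := Quotient.mk (hT.substSetoid Γ Δ) s

lemma Cls.homMk_comp {T : Theory 𝓛 Sg} (hT : IsBaseTheory T) {Γ Δ Ξ : List Sg.Srt}
    (s : Subst Δ Ξ) (t : Subst Γ Δ) : Cls.homMk hT s ≫ Cls.homMk hT t = Cls.homMk hT (t.comp s) := rfl

lemma Cls.exists_homMk {T : Theory 𝓛 Sg} {hT : IsBaseTheory T} {Δ Γ : Cls hT} (f : Δ ⟶ Γ) :
    ∃ s : Subst Γ.ctx Δ.ctx, Cls.homMk hT s = f := Quotient.exists_rep f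

/-- Pairing of morphisms into `[Γ, Γ']`. -/
def Cls.pair {T : Theory 𝓛 Sg} {hT : IsBaseTheory T} {Δ Γ Γ' : List Sg.Srt}
    (f : Cls.Hom hT Δ Γ)
    (g : Cls.Hom hT Δ Γ') :
    Cls.Hom hT Δ (Γ' ++ Γ) :=
  Quotient.map₂ (fun s t => Var.append t s)
    (by
      intro s s' hs t t' ht σ v
      have : ∀ {Γ' : List Sg.Srt} {t t' : Subst Γ' Δ},
          (∀ σ (v : Var Γ' σ), .eqn (t v) (t' v) ∈ T) → ∀ σ (v : Var (Γ' ++ Γ) σ),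
          .eqn (Var.append t s v) (Var.append t' s' v) ∈ T := by
        intro Γ'
        induction Γ' with
        | nil => intro t t' _ σ v; exact hs σ v
        | cons τ Γ' ih =>
          intro t t' ht σ v
          cases v with
          | zero => exact ht _ _
          | succ v => exact ih (fun _ w => ht _ w.succ) _ v
      exact this ht σ v) f g

lemma Cls.pair_mk {T : Theory 𝓛 Sg} (hT : IsBaseTheory T) {Δ Γ Γ' : List Sg.Srt}
    (s : Subst Γ Δ) (t : Subst Γ' Δ) :
    Cls.pair (Cls.homMk hT s) (Cls.homMk hT t) = Cls.homMk hT (Var.append t s) := rfl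

/-- The projection `[Γ, Γ'] ⟶ Γ`. -/
def Cls.projL {T : Theory 𝓛 Sg} (hT : IsBaseTheory T) (Γ Γ' : List Sg.Srt) :
    Cls.Hom hT (Γ' ++ Γ) Γ := Cls.homMk hT (Ren.sub (Var.inr Γ'))

/-- The projection `[Γ, Γ'] ⟶ Γ'`. -/
def Cls.projR {T : Theory 𝓛 Sg} (hT : IsBaseTheory T) (Γ Γ' : List Sg.Srt) :
    Cls.Hom hT (Γ' ++ Γ) Γ' := Cls.homMk hT (Ren.sub (Var.inl Γ))

lemma Cls.pair_fst {T : Theory 𝓛 Sg} {hT : IsBaseTheory T} {Δ Γ Γ' : List Sg.Srt}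
    (f : Cls.Hom hT Δ Γ)
    (g : Cls.Hom hT Δ Γ') :
    Cls.pair f g ≫ Cls.projL hT Γ Γ' = f := by
  obtain ⟨s, rfl⟩ := Cls.exists_homMk f
  obtain ⟨t, rfl⟩ := Cls.exists_homMk g
  rw [Cls.pair_mk, Cls.projL, Cls.homMk_comp]
  congr 1; funext σ v; exact Var.append_inr _ _ v

lemma Cls.pair_snd {T : Theory 𝓛 Sg} {hT : IsBaseTheory T} {Δ Γ Γ' : List Sg.Srt}
    (f : Cls.Hom hT Δ Γ)
    (g : Cls.Hom hT Δ Γ') :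
    Cls.pair f g ≫ Cls.projR hT Γ Γ' = g := by
  obtain ⟨s, rfl⟩ := Cls.exists_homMk f
  obtain ⟨t, rfl⟩ := Cls.exists_homMk g
  rw [Cls.pair_mk, Cls.projR, Cls.homMk_comp]
  congr 1; funext σ v; exact Var.append_inl _ _ v

lemma Cls.pair_eta {T : Theory 𝓛 Sg} {hT : IsBaseTheory T} {Δ Γ Γ' : List Sg.Srt}
    (m : Cls.Hom hT Δ (Γ' ++ Γ)) :
    Cls.pair (m ≫ Cls.projL hT Γ Γ') (m ≫ Cls.projR hT Γ Γ') = m := by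
  obtain ⟨s, rfl⟩ := Cls.exists_homMk m
  rw [Cls.projL, Cls.projR, Cls.homMk_comp, Cls.homMk_comp, Cls.pair_mk]
  congr 1; exact Var.append_eta s

/-- The designated products: the empty context, and concatenation `Γ × Γ' = [Γ, Γ']`. -/
instance Cls.cartesian {T : Theory 𝓛 Sg} (hT : IsBaseTheory T) :
    CartesianMonoidalCategory (Cls hT) :=
  .ofChosenFiniteProducts
    ⟨Limits.asEmptyCone (⟨[]⟩ : Cls hT),
      Limits.IsTerminal.ofUniqueHom (fun _ => Cls.homMk hT fun _ v => nomatch v) fun X m => by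
        obtain ⟨s, rfl⟩ := Cls.exists_homMk m
        congr 1; funext σ v; cases v⟩
    fun Γ Γ' => ⟨Limits.BinaryFan.mk (P := (⟨Γ'.ctx ++ Γ.ctx⟩ : Cls hT))
        (Cls.projL hT Γ.ctx Γ'.ctx) (Cls.projR hT Γ.ctx Γ'.ctx),
      Limits.BinaryFan.isLimitMk (fun c => Cls.pair c.fst c.snd)
        (fun c => Cls.pair_fst c.fst c.snd) (fun c => Cls.pair_snd c.fst c.snd)
        (fun c m h₁ h₂ => by
          rw [← Cls.pair_eta m]; exact congrArg₂ Cls.pair h₁ h₂)⟩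

lemma Cls.lift_mk {T : Theory 𝓛 Sg} (hT : IsBaseTheory T) {Δ Γ Γ' : List Sg.Srt}
    (s : Subst Γ Δ) (t : Subst Γ' Δ) :
    lift (Cls.homMk hT s) (Cls.homMk hT t) = Cls.homMk hT (Var.append t s) := by
  apply CartesianMonoidalCategory.hom_ext
  · rw [lift_fst]; exact (Cls.pair_fst (Cls.homMk hT s) (Cls.homMk hT t)).symm
  · rw [lift_snd]; exact (Cls.pair_snd (Cls.homMk hT s) (Cls.homMk hT t)).symm

/-- The action of a morphism on classes of formulas, by simultaneous substitution. -/
def FormCls.pull {T : Theory 𝓛 Sg} (hT : IsBaseTheory T) {Δ Γ : List Sg.Srt} (f : Cls.Hom hT Δ Γ) :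
    FormCls hT Γ →o FormCls hT Δ where
  toFun x := Quotient.map₂ (fun (s : Subst Γ Δ) (φ : Formula 𝓛 Sg Γ) => φ.subst s)
    (fun s s' (hs : ∀ σ v, Assertion.eqn (s v) (s' v) ∈ T) φ ψ
      (hφ : .seq [φ] ψ ∈ T ∧ .seq [ψ] φ ∈ T) =>
      ⟨hT.subst_seq hs hφ.1, hT.subst_seq (fun σ v => hT.symm (hs σ v)) hφ.2⟩) f x
  monotone' x y h := by
    obtain ⟨s, rfl⟩ := Cls.exists_homMk f
    obtain ⟨φ, rfl⟩ := x.exists_mk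
    obtain ⟨ψ, rfl⟩ := y.exists_mk
    exact hT.subst_seq (fun σ v => hT.refl (s v)) h

lemma FormCls.pull_mk {T : Theory 𝓛 Sg} (hT : IsBaseTheory T) {Δ Γ : List Sg.Srt}
    (s : Subst Γ Δ) (φ : Formula 𝓛 Sg Γ) :
    FormCls.pull hT (Cls.homMk hT s) (FormCls.mk hT φ) = FormCls.mk hT (φ.subst s) := rfl

/-- The functor `P_T`. -/
def Cls.functor {T : Theory 𝓛 Sg} (hT : IsBaseTheory T) : (Cls hT)ᵒᵖ ⥤ PartOrd.{max u v} where
  obj Γ := PartOrd.of (FormCls hT Γ.unop.ctx)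
  map f := PartOrd.ofHom (FormCls.pull hT f.unop)
  map_id Γ := by
    ext x
    obtain ⟨φ, rfl⟩ := FormCls.exists_mk x
    exact congrArg (FormCls.mk hT) φ.subst_id
  map_comp f g := by
    ext x
    obtain ⟨s, hs⟩ := Cls.exists_homMk f.unop
    obtain ⟨t, ht⟩ := Cls.exists_homMk g.unop
    obtain ⟨φ, rfl⟩ := FormCls.exists_mk x
    change FormCls.pull hT (g.unop ≫ f.unop) (FormCls.mk hT φ) =
      FormCls.pull hT g.unop (FormCls.pull hT f.unop (FormCls.mk hT φ))
    rw [← hs, ← ht]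
    exact congrArg (FormCls.mk hT) (Formula.subst_comp s t φ).symm

/-- `◇(φ₁/∼, …, φₙ/∼) = ◇(φ₁, …, φₙ)/∼`. -/
noncomputable def FormCls.conn {T : Theory 𝓛 Sg} (hT : IsBaseTheory T) (Γ : List Sg.Srt) {n : ℕ}
    (c : 𝓛.Conn n) (x : Fin n → FormCls hT Γ) : FormCls hT Γ :=
  FormCls.mk hT (.conn c fun i => Quotient.out (x i))

lemma FormCls.conn_mk {T : Theory 𝓛 Sg} (hT : IsBaseTheory T) {Γ : List Sg.Srt} {n : ℕ}
    (c : 𝓛.Conn n) (φ : Fin n → Formula 𝓛 Sg Γ) :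
    FormCls.conn hT Γ c (fun i => FormCls.mk hT (φ i)) = FormCls.mk hT (.conn c φ) := by
  have h : ∀ i, .seq [Quotient.out (FormCls.mk hT (φ i))] (φ i) ∈ T ∧
      .seq [φ i] (Quotient.out (FormCls.mk hT (φ i))) ∈ T := fun i =>
    Quotient.mk_out (s := hT.formulaSetoid Γ) (φ i)
  refine (FormCls.mk_eq hT).2 ⟨hT _ _ (.min (.conn_cong c _ _)) ?_,
    hT _ _ (.min (.conn_cong c _ _)) ?_⟩
  · rintro _ ⟨i, rfl | rfl⟩
    exacts [(h i).1, (h i).2]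
  · rintro _ ⟨i, rfl | rfl⟩
    exacts [(h i).2, (h i).1]

lemma FormCls.unit_mk {T : Theory 𝓛 Sg} (hT : IsBaseTheory T) (Γ : List Sg.Srt) :
    FormCls.conn hT Γ 𝓛.unit ![] = FormCls.mk hT .unit := by
  rw [Formula.unit, ← FormCls.conn_mk]
  congr 1; funext i; exact i.elim0

lemma FormCls.tensor_mk {T : Theory 𝓛 Sg} (hT : IsBaseTheory T) {Γ : List Sg.Srt}
    (φ ψ : Formula 𝓛 Sg Γ) :
    FormCls.conn hT Γ 𝓛.tensor ![FormCls.mk hT φ, FormCls.mk hT ψ] =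
      FormCls.mk hT (φ.tensor ψ) := by
  rw [Formula.tensor, ← FormCls.conn_mk]
  congr 1; funext i; fin_cases i <;> rfl

/-- Quantification over a context: `Ω_{y₁} ⋯ Ω_{yₘ} φ` for `Γ' = y₁, …, yₘ`. -/
def Formula.quantCtx (q : Quantifier) {Γ : List Sg.Srt} :
    (Γ' : List Sg.Srt) → Formula 𝓛 Sg (Γ' ++ Γ) → Formula 𝓛 Sg Γ
  | [], φ => φ
  | σ :: Γ', φ => Formula.quantCtx q Γ' (.quant q σ φ)

/-- `Ω_{Γ,Γ'}(φ/∼) = (Ω_{y₁} ⋯ Ω_{yₘ} φ)/∼`. -/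
def FormCls.quant {T : Theory 𝓛 Sg} (hT : IsBaseTheory T) (q : Quantifier)
    (Γ Γ' : List Sg.Srt) : FormCls hT (Γ' ++ Γ) → FormCls hT Γ :=
  Quotient.map (Formula.quantCtx q Γ') (by
    induction Γ' with
    | nil => exact fun φ ψ h => h
    | cons σ Γ' ih =>
      exact fun φ ψ h => ih
        ⟨hT _ _ (.min (.quant_con q σ φ ψ)) (by rintro _ (rfl | rfl); exacts [h.1, h.2]),
          hT _ _ (.min (.quant_con q σ ψ φ)) (by rintro _ (rfl | rfl); exacts [h.2, h.1])⟩)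

lemma FormCls.quant_mk {T : Theory 𝓛 Sg} (hT : IsBaseTheory T) (q : Quantifier)
    {Γ Γ' : List Sg.Srt} (φ : Formula 𝓛 Sg (Γ' ++ Γ)) :
    FormCls.quant hT q Γ Γ' (FormCls.mk hT φ) = FormCls.mk hT (φ.quantCtx q Γ') := rfl

/-- Extension of a substitution by the variables of `Γ'`. -/
def Subst.liftCtx {Γ Δ : List Sg.Srt} (Γ' : List Sg.Srt) (s : Subst Γ Δ) :
    Subst (Γ' ++ Γ) (Γ' ++ Δ) :=
  Var.append (Ren.sub (Var.inl Δ)) (s.comp (Ren.sub (Var.inr Γ')))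

lemma Subst.liftCtx_cons {Γ Δ : List Sg.Srt} (σ : Sg.Srt) (Γ' : List Sg.Srt) (s : Subst Γ Δ) :
    s.liftCtx (σ :: Γ') = (s.liftCtx Γ').lift σ := by
  refine Var.append_ext (Γ' := σ :: Γ') ?_ ?_
  · intro τ v
    refine (Var.append_inl _ _ v).trans ?_
    cases v with
    | zero => rfl
    | succ v =>
      change _ = (Subst.liftCtx Γ' s (Var.inl Γ v)).subst (Subst.wk σ)
      rw [Subst.liftCtx, Var.append_inl]; rfl
  · intro τ v
    refine (Var.append_inr _ _ v).trans ?_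
    change _ = (Subst.liftCtx Γ' s (Var.inr Γ' v)).subst (Subst.wk σ)
    rw [Subst.liftCtx, Var.append_inr, Subst.comp, Subst.comp, Term.subst_comp]
    rfl

lemma Formula.quantCtx_subst (q : Quantifier) {Γ Δ : List Sg.Srt} (s : Subst Γ Δ)
    (Γ' : List Sg.Srt) (φ : Formula 𝓛 Sg (Γ' ++ Γ)) :
    (φ.quantCtx q Γ').subst s = (φ.subst (s.liftCtx Γ')).quantCtx q Γ' := by
  induction Γ' with
  | nil =>
    change φ.subst s = φ.subst (s.comp (Subst.id Δ))
    rw [Subst.comp_id]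
  | cons σ Γ' ih =>
    rw [Subst.liftCtx_cons]
    exact ih (.quant q σ φ)

/-- The reassociation substitution between `[Γ, [Γ', Γ'']]` and `[[Γ, Γ'], Γ'']`. -/
def Subst.assoc (Γ Γ' Γ'' : List Sg.Srt) :
    Subst (Γ'' ++ (Γ' ++ Γ)) ((Γ'' ++ Γ') ++ Γ) :=
  Var.append (Ren.sub fun _ v => Var.inl Γ (Var.inl Γ' v))
    (Var.append (Ren.sub fun _ v => Var.inl Γ (Var.inr Γ'' v)) (Ren.sub (Var.inr (Γ'' ++ Γ'))))

lemma Subst.assoc_nil (Γ Γ' : List Sg.Srt) : Subst.assoc Γ Γ' [] = Subst.id (Γ' ++ Γ) :=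
  Var.append_eta (Subst.id (Γ' ++ Γ))

lemma Subst.assoc_cons (Γ Γ' Γ'' : List Sg.Srt) (σ : Sg.Srt) :
    Subst.assoc Γ Γ' (σ :: Γ'') = (Subst.assoc Γ Γ' Γ'').lift σ := by
  refine Var.append_ext (Γ' := σ :: Γ'') ?_ ?_
  · intro τ v
    refine (Var.append_inl _ _ v).trans ?_
    cases v with
    | zero => rfl
    | succ v =>
      change _ = (Subst.assoc Γ Γ' Γ'' (Var.inl _ v)).subst (Subst.wk σ)
      rw [Subst.assoc, Var.append_inl]; rfl
  · intro τ v
    refine (Var.append_inr _ _ v).trans ?_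
    change _ = (Subst.assoc Γ Γ' Γ'' (Var.inr Γ'' v)).subst (Subst.wk σ)
    rw [Subst.assoc, Var.append_inr]
    have h := congrFun (congrFun (Subst.append_comp
      (Ren.sub fun _ v => Var.inl Γ (Var.inr Γ'' v) : Subst Γ' ((Γ'' ++ Γ') ++ Γ))
      (Ren.sub (Var.inr (Γ'' ++ Γ'))) (Subst.wk σ)) τ) v
    exact h.symm

lemma Formula.quantCtx_assoc (q : Quantifier) (Γ Γ' Γ'' : List Sg.Srt)
    (φ : Formula 𝓛 Sg (Γ'' ++ (Γ' ++ Γ))) :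
    (φ.subst (Subst.assoc Γ Γ' Γ'')).quantCtx q (Γ'' ++ Γ') =
      (φ.quantCtx q Γ'').quantCtx q Γ' := by
  induction Γ'' with
  | nil => rw [Subst.assoc_nil]; exact congrArg (Formula.quantCtx q Γ') (Formula.subst_id φ)
  | cons σ Γ'' ih =>
    rw [Subst.assoc_cons]
    exact ih (.quant q σ φ)

/-- The conjunction (by `⊗`) of the equations between two tuples of terms. -/
def Formula.eqTuple {Δ : List Sg.Srt} :
    {Γ : List Sg.Srt} → Subst Γ Δ → Subst Γ Δ → Formula 𝓛 Sg Δ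
  | [], _, _ => .unit
  | _ :: _, s, t => (Formula.eqTuple (fun _ v => s v.succ) (fun _ v => t v.succ)).tensor
      (.eq (s .zero) (t .zero))

lemma Formula.unit_subst {Γ Δ : List Sg.Srt} (s : Subst Γ Δ) :
    (Formula.unit : Formula 𝓛 Sg Γ).subst s = .unit := by
  simp only [Formula.unit, Formula.subst]
  congr 1; funext i; exact i.elim0

lemma Formula.tensor_subst {Γ Δ : List Sg.Srt} (s : Subst Γ Δ) (φ ψ : Formula 𝓛 Sg Γ) :
    (φ.tensor ψ).subst s = (φ.subst s).tensor (ψ.subst s) := by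
  simp only [Formula.tensor, Formula.subst]
  congr 1; funext i; fin_cases i <;> rfl

lemma Formula.eqTuple_subst {Γ Δ Ξ : List Sg.Srt} (s t : Subst Γ Δ) (r : Subst Δ Ξ) :
    (Formula.eqTuple s t : Formula 𝓛 Sg Δ).subst r = Formula.eqTuple (s.comp r) (t.comp r) := by
  induction Γ with
  | nil => exact Formula.unit_subst r
  | cons σ Γ ih =>
    simp only [Formula.eqTuple, Formula.tensor_subst, ih]; rfl

/-- `Eq_Γ = (x₁ = x₁' ⊗ ⋯ ⊗ xₙ = xₙ')/∼`, over `[Γ, Γ']`, where `Γ'` is a copy of `Γ`. -/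
def FormCls.eq {T : Theory 𝓛 Sg} (hT : IsBaseTheory T) (Γ : List Sg.Srt) :
    FormCls hT (Γ ++ Γ) :=
  FormCls.mk hT (.eqTuple (Ren.sub (Var.inr Γ)) (Ren.sub (Var.inl Γ)))

lemma FormCls.tensor_assoc {T : Theory 𝓛 Sg} (hT : IsBaseTheory T) {Γ : List Sg.Srt}
    (x y z : FormCls hT Γ) :
    FormCls.conn hT Γ 𝓛.tensor ![FormCls.conn hT Γ 𝓛.tensor ![x, y], z] =
      FormCls.conn hT Γ 𝓛.tensor ![x, FormCls.conn hT Γ 𝓛.tensor ![y, z]] := by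
  obtain ⟨α, rfl⟩ := x.exists_mk
  obtain ⟨β, rfl⟩ := y.exists_mk
  obtain ⟨γ, rfl⟩ := z.exists_mk
  simp only [FormCls.tensor_mk]
  have ax : ∀ φ : Formula 𝓛 Sg Γ, .seq [φ] φ ∈ T := fun φ => hT _ _ (.min (.ax φ)) (by simp)
  refine (FormCls.mk_eq hT).2 ⟨?_, ?_⟩
  · refine hT _ _ (.min (.tensor_down [] [] _ _ _)) (Set.singleton_subset_iff.2 ?_)
    refine hT _ _ (.min (.tensor_down [] [γ] _ _ _)) (Set.singleton_subset_iff.2 ?_)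
    refine hT _ _ (.min (.tensor_up [α] [] _ _ _)) (Set.singleton_subset_iff.2 ?_)
    exact hT _ _ (.min (.tensor_up [] [] _ _ _)) (Set.singleton_subset_iff.2 (ax _))
  · refine hT _ _ (.min (.tensor_down [] [] _ _ _)) (Set.singleton_subset_iff.2 ?_)
    refine hT _ _ (.min (.tensor_down [α] [] _ _ _)) (Set.singleton_subset_iff.2 ?_)
    refine hT _ _ (.min (.tensor_up [] [γ] _ _ _)) (Set.singleton_subset_iff.2 ?_)
    exact hT _ _ (.min (.tensor_up [] [] _ _ _)) (Set.singleton_subset_iff.2 (ax _))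

lemma FormCls.unit_tensor {T : Theory 𝓛 Sg} (hT : IsBaseTheory T) {Γ : List Sg.Srt}
    (x : FormCls hT Γ) :
    FormCls.conn hT Γ 𝓛.tensor ![FormCls.conn hT Γ 𝓛.unit ![], x] = x := by
  obtain ⟨α, rfl⟩ := x.exists_mk
  rw [FormCls.unit_mk, FormCls.tensor_mk]
  have ax : ∀ φ : Formula 𝓛 Sg Γ, .seq [φ] φ ∈ T := fun φ => hT _ _ (.min (.ax φ)) (by simp)
  refine (FormCls.mk_eq hT).2 ⟨?_, ?_⟩
  · refine hT _ _ (.min (.tensor_down [] [] _ _ _)) (Set.singleton_subset_iff.2 ?_)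
    exact hT _ _ (.min (.unit_up [] [α] _)) (Set.singleton_subset_iff.2 (ax _))
  · refine hT _ _ (.min (.unit_down [] [α] _)) (Set.singleton_subset_iff.2 ?_)
    exact hT _ _ (.min (.tensor_up [] [] _ _ _)) (Set.singleton_subset_iff.2 (ax _))

lemma FormCls.tensor_unit {T : Theory 𝓛 Sg} (hT : IsBaseTheory T) {Γ : List Sg.Srt}
    (x : FormCls hT Γ) :
    FormCls.conn hT Γ 𝓛.tensor ![x, FormCls.conn hT Γ 𝓛.unit ![]] = x := by
  obtain ⟨α, rfl⟩ := x.exists_mk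
  rw [FormCls.unit_mk, FormCls.tensor_mk]
  have ax : ∀ φ : Formula 𝓛 Sg Γ, .seq [φ] φ ∈ T := fun φ => hT _ _ (.min (.ax φ)) (by simp)
  refine (FormCls.mk_eq hT).2 ⟨?_, ?_⟩
  · refine hT _ _ (.min (.tensor_down [] [] _ _ _)) (Set.singleton_subset_iff.2 ?_)
    exact hT _ _ (.min (.unit_up [α] [] _)) (Set.singleton_subset_iff.2 (ax _))
  · refine hT _ _ (.min (.unit_down [α] [] _)) (Set.singleton_subset_iff.2 ?_)
    exact hT _ _ (.min (.tensor_up [] [] _ _ _)) (Set.singleton_subset_iff.2 (ax _))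

lemma FormCls.eqTuple_append {T : Theory 𝓛 Sg} (hT : IsBaseTheory T) {Γ Γ' Δ : List Sg.Srt}
    (s t : Subst Γ Δ) (s' t' : Subst Γ' Δ) :
    FormCls.mk hT (.eqTuple (Var.append s' s) (Var.append t' t)) =
      FormCls.conn hT Δ 𝓛.tensor
        ![FormCls.mk hT (.eqTuple s t), FormCls.mk hT (.eqTuple s' t')] := by
  induction Γ' with
  | nil =>
    change FormCls.mk hT (.eqTuple s t) = FormCls.conn hT Δ 𝓛.tensor
      ![FormCls.mk hT (.eqTuple s t), FormCls.mk hT .unit]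
    rw [← FormCls.unit_mk, FormCls.tensor_unit]
  | cons σ Γ' ih =>
    change FormCls.mk hT ((Formula.eqTuple (Var.append (fun _ v => s' v.succ) s)
      (Var.append (fun _ v => t' v.succ) t)).tensor (.eq (s' .zero) (t' .zero))) = _
    rw [← FormCls.tensor_mk, ih, FormCls.tensor_assoc, FormCls.tensor_mk]
    rfl

lemma Cls.whiskerRight_mk {T : Theory 𝓛 Sg} (hT : IsBaseTheory T) {Γ Δ : List Sg.Srt}
    (s : Subst Γ Δ) (Γ' : List Sg.Srt) :
    Cls.homMk hT s ▷ ⟨Γ'⟩ = Cls.homMk hT (s.liftCtx Γ') := by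
  refine Eq.trans ?_ (Cls.lift_mk hT (s.comp (Ren.sub (Var.inr Γ'))) (Ren.sub (Var.inl Δ)))
  apply CartesianMonoidalCategory.hom_ext
  · rw [lift_fst, whiskerRight_fst]; rfl
  · rw [lift_snd, whiskerRight_snd]; rfl

lemma Cls.associator_inv_mk {T : Theory 𝓛 Sg} (hT : IsBaseTheory T) (Γ Γ' Γ'' : List Sg.Srt) :
    (α_ (⟨Γ⟩ : Cls hT) ⟨Γ'⟩ ⟨Γ''⟩).inv = Cls.homMk hT (Subst.assoc Γ Γ' Γ'') := by
  have h1 : (α_ (⟨Γ⟩ : Cls hT) ⟨Γ'⟩ ⟨Γ''⟩).inv = lift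
      (lift (CartesianMonoidalCategory.fst _ _)
        (CartesianMonoidalCategory.snd _ _ ≫ CartesianMonoidalCategory.fst _ _))
      (CartesianMonoidalCategory.snd _ _ ≫ CartesianMonoidalCategory.snd _ _) := by
    apply CartesianMonoidalCategory.hom_ext
    · rw [lift_fst]
      apply CartesianMonoidalCategory.hom_ext <;> simp
    · simp
  rw [h1]
  have h2 := Cls.lift_mk hT (Ren.sub (Var.inr (Γ'' ++ Γ')))
    (Ren.sub fun _ v => Var.inl Γ (Var.inr Γ'' v) : Subst Γ' ((Γ'' ++ Γ') ++ Γ))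
  have h3 := Cls.lift_mk hT (Var.append
    (Ren.sub fun _ v => Var.inl Γ (Var.inr Γ'' v) : Subst Γ' ((Γ'' ++ Γ') ++ Γ))
    (Ren.sub (Var.inr (Γ'' ++ Γ')))) (Ren.sub fun _ v => Var.inl Γ (Var.inl Γ' v))
  exact (congrArg (fun f => lift f (Cls.homMk hT (Ren.sub fun _ v => Var.inl Γ (Var.inl Γ' v))))
    h2).trans h3

lemma FormCls.pull_eq {T : Theory 𝓛 Sg} (hT : IsBaseTheory T) {Γ Δ : List Sg.Srt}
    (s t : Subst Γ Δ) :
    FormCls.pull hT (Cls.homMk hT (Var.append t s)) (FormCls.eq hT Γ) =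
      FormCls.mk hT (.eqTuple s t) := by
  rw [FormCls.eq, FormCls.pull_mk, Formula.eqTuple_subst]
  congr 2 <;> funext σ v
  · exact Var.append_inr _ _ v
  · exact Var.append_inl _ _ v

lemma FormCls.eq_prod {T : Theory 𝓛 Sg} (hT : IsBaseTheory T) (Γ Γ' : List Sg.Srt) :
    FormCls.eq hT (Γ' ++ Γ) = FormCls.conn hT ((Γ' ++ Γ) ++ (Γ' ++ Γ)) 𝓛.tensor
      ![FormCls.pull hT (Cls.homMk hT (Var.append
            (Ren.sub fun _ v => Var.inl (Γ' ++ Γ) (Var.inr Γ' v))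
            (Ren.sub fun _ v => Var.inr (Γ' ++ Γ) (Var.inr Γ' v)))) (FormCls.eq hT Γ),
        FormCls.pull hT (Cls.homMk hT (Var.append
            (Ren.sub fun _ v => Var.inl (Γ' ++ Γ) (Var.inl Γ v))
            (Ren.sub fun _ v => Var.inr (Γ' ++ Γ) (Var.inl Γ v)))) (FormCls.eq hT Γ')] := by
  rw [FormCls.pull_eq, FormCls.pull_eq, ← FormCls.eqTuple_append, FormCls.eq]
  congr 2
  · exact (Var.append_eta _).symm
  · exact (Var.append_eta _).symm

/-- The classifying prop-category `(C_T, P_T)`. -/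
noncomputable def classifying {T : Theory 𝓛 Sg} (hT : IsBaseTheory T) : PropCat.{u, v} 𝓛 where
  C := Cls hT
  P := Cls.functor hT
  conn Γ _ c x := FormCls.conn hT Γ.ctx c x
  conn_map {Δ Γ} f n c x := by
    obtain ⟨s, rfl⟩ := Cls.exists_homMk f
    choose φ hφ using fun i => FormCls.exists_mk (x i)
    obtain rfl : (fun i => FormCls.mk hT (φ i)) = x := funext hφ
    exact (congrArg (FormCls.pull hT (Cls.homMk hT s)) (FormCls.conn_mk hT c φ)).trans
      (FormCls.conn_mk hT c fun i => (φ i).subst s).symm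
  eq Γ := FormCls.eq hT Γ.ctx
  quant q Γ Γ' := FormCls.quant hT q Γ.ctx Γ'.ctx
  quant_nat q Δ Γ f Γ' x := by
    obtain ⟨s, rfl⟩ := Cls.exists_homMk f
    obtain ⟨φ, rfl⟩ := FormCls.exists_mk x
    have h := Cls.whiskerRight_mk hT s Γ'.ctx
    refine Eq.trans ?_ (congrArg (fun g => FormCls.quant hT q Δ.ctx Γ'.ctx
      (FormCls.pull hT g (FormCls.mk hT φ))) h).symm
    exact congrArg (FormCls.mk hT) (Formula.quantCtx_subst q s Γ'.ctx φ)
  tensor_assoc _ := FormCls.tensor_assoc hT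
  unit_tensor _ := FormCls.unit_tensor hT
  tensor_unit _ := FormCls.tensor_unit hT
  quant_one q Γ x := by
    obtain ⟨φ, rfl⟩ := FormCls.exists_mk x
    exact congrArg (FormCls.mk hT) φ.subst_id
  quant_prod q Γ Γ' Γ'' x := by
    obtain ⟨φ, rfl⟩ := FormCls.exists_mk x
    have h := Cls.associator_inv_mk hT Γ.ctx Γ'.ctx Γ''.ctx
    refine (congrArg (fun g => FormCls.quant hT q Γ.ctx (Γ''.ctx ++ Γ'.ctx)
      (FormCls.pull hT g (FormCls.mk hT φ))) h).trans ?_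
    exact congrArg (FormCls.mk hT) (Formula.quantCtx_assoc q Γ.ctx Γ'.ctx Γ''.ctx φ)
  eq_one := (FormCls.unit_mk hT []).symm
  eq_prod Γ Γ' := by
    have h1 := Cls.lift_mk hT (Ren.sub fun _ v => Var.inr (Γ'.ctx ++ Γ.ctx) (Var.inr Γ'.ctx v))
      (Ren.sub fun _ v => Var.inl (Γ'.ctx ++ Γ.ctx) (Var.inr Γ'.ctx v))
    have h2 := Cls.lift_mk hT (Ren.sub fun _ v => Var.inr (Γ'.ctx ++ Γ.ctx) (Var.inl Γ.ctx v))
      (Ren.sub fun _ v => Var.inl (Γ'.ctx ++ Γ.ctx) (Var.inl Γ.ctx v))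
    have e1 := congrArg (fun f => FormCls.pull hT f (FormCls.eq hT Γ.ctx)) h1
    have e2 := congrArg (fun f => FormCls.pull hT f (FormCls.eq hT Γ'.ctx)) h2
    exact (FormCls.eq_prod hT Γ.ctx Γ'.ctx).trans (congrArg₂ (fun x y => FormCls.conn hT
      ((Γ'.ctx ++ Γ.ctx) ++ (Γ'.ctx ++ Γ.ctx)) 𝓛.tensor ![x, y]) e1 e2).symm

/-- The class of the classifying prop-categories of all `L`-theories, over all signatures. -/
def Logic.classifyingClass (L : Logic 𝓛) : Set (PropCat.{u, v} 𝓛) :=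
  {A | ∃ (Sg : Signature.{u}) (T : Theory 𝓛 Sg) (hT : L.IsTheory T), A = classifying hT.base}

end FibLogic

namespace FibLogic

open CategoryTheory MonoidalCategory CartesianMonoidalCategory Opposite

variable {𝓛 : Language.{v}} {Sg : Signature.{u}}

/-! ## Soundness of the base rules in every prop-category -/

/-! Soundness rests on two observations. First, the base rules hold in every object of `FA`:
substitution is interpreted by precomposition, the monoid laws give the rules for `⊗` and `e`, and
antisymmetry turns mutual entailment into equality, which every connective and quantifier respects
whether or not it is monotone. Second, although nothing in `FA` forces the optional rules, a
classifying prop-category is made of syntax: a structure in `(C_T, P_T)` interprets each formula by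
the class of a formula over the signature of `T`, and by `Str.sat_seq_iff` it satisfies a sequent
exactly when the sequent of chosen representatives belongs to `T`. An instance of a propositional
rule thus becomes an instance of the same rule, under which `T` is closed.

The adjoint rules need more, because one sort may be interpreted by a whole context: a quantifier
becomes a block of quantifiers and an equation becomes a product of equations.
`Logic.IsTheory.exAdj_iff`, `Logic.IsTheory.allAdj_iff` and `Logic.IsTheory.eqAdj_iff` extend the
one-variable rules to contexts by induction. For equality, the variable being copied need not be the
last of its context, so the context is first permuted by an invertible renaming.

Completeness is a canonical model argument. The closure of `T` is an `L`-theory, and the generic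
structure in its classifying prop-category interprets every term and formula by itself, up to
renaming of variables (`genericStr_term`, `genericStr_formula`). Hence it satisfies exactly the
assertions derivable from `T` (`genericStr_sat_iff`): it is a `T`-model, and whatever holds in all
`T`-models over the class is derivable. -/

lemma PropCat.map_comp (A : PropCat.{u, v} 𝓛) {a b c : A.C} (f : a ⟶ b) (g : b ⟶ c)
    (x : A.P.obj (op c)) : A.P.map (f ≫ g).op x = A.P.map f.op (A.P.map g.op x) := by
  simp

lemma PropCat.map_mono (A : PropCat.{u, v} 𝓛) {a b : A.C} (f : a ⟶ b)
    {x y : A.P.obj (op b)} (h : x ≤ y) : A.P.map f.op x ≤ A.P.map f.op y :=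
  (A.P.map f.op).hom.monotone h

lemma PropCat.map_tensor (A : PropCat.{u, v} 𝓛) {a b : A.C} (f : a ⟶ b)
    (x y : A.P.obj (op b)) : A.P.map f.op (A.conn b 𝓛.tensor ![x, y]) =
      A.conn a 𝓛.tensor ![A.P.map f.op x, A.P.map f.op y] := by
  rw [A.conn_map]; congr 1; funext i; fin_cases i <;> rfl

lemma PropCat.map_unit (A : PropCat.{u, v} 𝓛) {a b : A.C} (f : a ⟶ b) :
    A.P.map f.op (A.conn b 𝓛.unit ![]) = A.conn a 𝓛.unit ![] := by
  rw [A.conn_map]; congr 1; funext i; exact i.elim0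

lemma PropCat.map_tensorList (A : PropCat.{u, v} 𝓛) {a b : A.C} (f : a ⟶ b)
    (l : List (A.P.obj (op b))) :
    A.P.map f.op (A.tensorList b l) = A.tensorList a (l.map (A.P.map f.op)) := by
  induction l with
  | nil => exact A.map_unit f
  | cons x l ih =>
    exact (A.map_tensor f x (A.tensorList b l)).trans
      (congrArg (fun y => A.conn a 𝓛.tensor ![A.P.map f.op x, y]) ih)

lemma PropCat.tensorList_singleton (A : PropCat.{u, v} 𝓛) {c : A.C} (x : A.P.obj (op c)) :
    A.tensorList c [x] = x :=
  A.tensor_unit c x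

lemma PropCat.tensorList_append (A : PropCat.{u, v} 𝓛) {c : A.C}
    (l l' : List (A.P.obj (op c))) : A.tensorList c (l ++ l') =
      A.conn c 𝓛.tensor ![A.tensorList c l, A.tensorList c l'] := by
  induction l with
  | nil => exact (A.unit_tensor c _).symm
  | cons x l ih =>
    change A.conn c 𝓛.tensor ![x, A.tensorList c (l ++ l')] =
      A.conn c 𝓛.tensor ![A.conn c 𝓛.tensor ![x, A.tensorList c l], A.tensorList c l']
    rw [ih, A.tensor_assoc]

/-! ### Finite products indexed by contexts -/

lemma PropCat.tuple_proj (A : PropCat.{u, v} 𝓛) {S : Type u} (o : S → A.C) {X : A.C}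
    {Γ : List S} (s : ∀ ⦃σ⦄, Var Γ σ → (X ⟶ o σ)) {σ : S} (v : Var Γ σ) :
    A.tuple o s ≫ A.proj o v = s v := by
  induction v with
  | zero => exact lift_snd _ _
  | succ v ih =>
    change lift _ _ ≫ CartesianMonoidalCategory.fst _ _ ≫ A.proj o v = _
    rw [lift_fst_assoc, ih]

lemma PropCat.comp_tuple (A : PropCat.{u, v} 𝓛) {S : Type u} (o : S → A.C) {X Y : A.C}
    (f : Y ⟶ X) {Γ : List S} (s : ∀ ⦃σ⦄, Var Γ σ → (X ⟶ o σ)) :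
    f ≫ A.tuple o s = A.tuple o fun _ v => f ≫ s v := by
  induction Γ with
  | nil => exact toUnit_unique _ _
  | cons σ Γ ih =>
    change f ≫ lift _ _ = lift _ _
    rw [comp_lift, ih]

lemma PropCat.tuple_proj_self (A : PropCat.{u, v} 𝓛) {S : Type u} (o : S → A.C) (Γ : List S) :
    A.tuple o (fun _ (v : Var Γ _) => A.proj o v) = 𝟙 (A.ctx o Γ) := by
  induction Γ with
  | nil => exact toUnit_unique _ _
  | cons σ Γ ih =>
    change lift (A.tuple o fun _ v => CartesianMonoidalCategory.fst _ _ ≫ A.proj o v)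
      (CartesianMonoidalCategory.snd _ _) = _
    rw [← A.comp_tuple, ih, Category.comp_id]
    exact lift_fst_snd

/-- Interpretation of a tuple of terms. -/
def Str.sub {A : PropCat.{u, v} 𝓛} (S : Str Sg A) {Γ Δ : List Sg.Srt} (s : Subst Γ Δ) :
    A.ctx S.srt Δ ⟶ A.ctx S.srt Γ :=
  A.tuple S.srt fun _ v => S.term (s v)

/-! ### Substitution as precomposition -/

lemma Str.term_subst {A : PropCat.{u, v} 𝓛} (S : Str Sg A) {Γ Δ : List Sg.Srt}
    (s : Subst Γ Δ) {τ : Sg.Srt} (M : Term Sg Γ τ) :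
    S.term (M.subst s) = S.sub s ≫ S.term M := by
  induction M with
  | var v => exact (A.tuple_proj S.srt (fun _ v => S.term (s v)) v).symm
  | app f M ih =>
    simp only [Term.subst, Str.term, ih, ← A.comp_tuple, Category.assoc]

lemma Str.sub_id {A : PropCat.{u, v} 𝓛} (S : Str Sg A) (Γ : List Sg.Srt) :
    S.sub (Subst.id Γ) = 𝟙 _ :=
  A.tuple_proj_self S.srt Γ

lemma Str.sub_wk {A : PropCat.{u, v} 𝓛} (S : Str Sg A) (Γ : List Sg.Srt) (σ : Sg.Srt) :
    S.sub (Subst.wk (Γ := Γ) σ) = CartesianMonoidalCategory.fst _ _ := by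
  refine (A.comp_tuple S.srt (CartesianMonoidalCategory.fst _ (S.srt σ)) _).symm.trans ?_
  rw [A.tuple_proj_self, Category.comp_id]

lemma Str.sub_comp {A : PropCat.{u, v} 𝓛} (S : Str Sg A) {Γ Δ Ξ : List Sg.Srt}
    (s : Subst Γ Δ) (t : Subst Δ Ξ) : S.sub (s.comp t) = S.sub t ≫ S.sub s := by
  refine Eq.trans ?_ (A.comp_tuple S.srt (S.sub t) _).symm
  exact congrArg (A.tuple S.srt) (by funext σ v; exact S.term_subst t (s v))

/-- Passing under a binder corresponds to whiskering, which is the form of reindexing in the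
naturality axiom for quantifiers. -/
lemma Str.sub_lift {A : PropCat.{u, v} 𝓛} (S : Str Sg A) {Γ Δ : List Sg.Srt}
    (s : Subst Γ Δ) (σ : Sg.Srt) : S.sub (s.lift σ) = S.sub s ▷ S.srt σ := by
  change lift (S.sub (s.comp (Subst.wk σ))) (CartesianMonoidalCategory.snd _ _) = _
  rw [S.sub_comp, S.sub_wk]
  exact CartesianMonoidalCategory.hom_ext _ _
    ((lift_fst _ _).trans (whiskerRight_fst _ _).symm)
    ((lift_snd _ _).trans (whiskerRight_snd _ _).symm)

/-- Each case is one axiom of `FA`: functoriality of `P` for atomic formulas, the homomorphism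
property for connectives, and naturality of `Ω` in its first argument for quantifiers. -/
lemma Str.formula_subst {A : PropCat.{u, v} 𝓛} (S : Str Sg A) {Γ Δ : List Sg.Srt}
    (φ : Formula 𝓛 Sg Γ) (s : Subst Γ Δ) :
    S.formula (φ.subst s) = A.P.map (S.sub s).op (S.formula φ) := by
  induction φ generalizing Δ with
  | rel R M =>
    change A.P.map (S.sub (M.comp s)).op _ = A.P.map _ (A.P.map (S.sub M).op _)
    rw [S.sub_comp, A.map_comp]
  | eq M N =>
    simp only [Formula.subst, Str.formula, S.term_subst]
    rw [← comp_lift, A.map_comp]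
  | conn c φ ih =>
    simp only [Formula.subst, Str.formula, ih]
    exact (A.conn_map (S.sub s) c _).symm
  | quant q σ φ ih =>
    simp only [Formula.subst, Str.formula, ih, S.sub_lift]
    exact (A.quant_nat q (S.sub s) (S.srt σ) _).symm

lemma Str.formula_tensor {A : PropCat.{u, v} 𝓛} (S : Str Sg A) {Γ : List Sg.Srt}
    (φ ψ : Formula 𝓛 Sg Γ) :
    S.formula (φ.tensor ψ) = A.conn _ 𝓛.tensor ![S.formula φ, S.formula ψ] := by
  simp only [Formula.tensor, Str.formula]
  congr 1; funext i; fin_cases i <;> rfl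

lemma Str.formula_unit {A : PropCat.{u, v} 𝓛} (S : Str Sg A) {Γ : List Sg.Srt} :
    S.formula (Formula.unit : Formula 𝓛 Sg Γ) = A.conn _ 𝓛.unit ![] := by
  simp only [Formula.unit, Str.formula]
  congr 1; funext i; exact i.elim0

lemma Str.map_formula_subst {A : PropCat.{u, v} 𝓛} (S : Str Sg A) {Γ Δ : List Sg.Srt}
    (Φ : List (Formula 𝓛 Sg Γ)) (s : Subst Γ Δ) :
    (Φ.map (·.subst s)).map S.formula = (Φ.map S.formula).map (A.P.map (S.sub s).op) := by
  rw [List.map_map, List.map_map]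
  exact List.map_congr_left fun φ _ => S.formula_subst φ s

lemma Str.sat_singleton {A : PropCat.{u, v} 𝓛} (S : Str Sg A) {Γ : List Sg.Srt}
    (φ ψ : Formula 𝓛 Sg Γ) : S.Sat (.seq [φ] ψ) ↔ S.formula φ ≤ S.formula ψ := by
  change A.tensorList _ [S.formula φ] ≤ _ ↔ _
  rw [A.tensorList_singleton]

/-- The two sides may use syntactically different substitutions as long as these denote the same
morphism. This covers both Cwk, with equal substitutions, and Sub, where they differ by a satisfied
equation. -/
lemma Str.sat_subst {A : PropCat.{u, v} 𝓛} (S : Str Sg A) {Γ Δ : List Sg.Srt}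
    {Φ : List (Formula 𝓛 Sg Γ)} {ψ : Formula 𝓛 Sg Γ} (h : S.Sat (.seq Φ ψ))
    {s s' : Subst Γ Δ} (hs : S.sub s = S.sub s') :
    S.Sat (.seq (Φ.map (·.subst s)) (ψ.subst s')) := by
  change A.tensorList _ _ ≤ _
  rw [S.map_formula_subst, S.formula_subst, ← A.map_tensorList, hs]
  exact A.map_mono _ h

/-- The morphism denoted by `[M/x]` depends on `M` only through its interpretation; this is where
the equational premise of the substitution rules enters. -/
lemma Str.sub_single {A : PropCat.{u, v} 𝓛} (S : Str Sg A) {Γ Γ' : List Sg.Srt} {σ : Sg.Srt}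
    {M M' : Term Sg (Γ' ++ Γ) σ} (h : S.term M = S.term M') :
    S.sub (Subst.single Γ Γ' M) = S.sub (Subst.single Γ Γ' M') := by
  refine congrArg (A.tuple S.srt) (Var.append_ext ?_ ?_) <;> intro τ v
  · simp only [Subst.single, Var.append_inl]
  · simp only [Subst.single, Var.append_inr]
    cases v with
    | zero => exact h
    | succ v => rfl

/-! ### The equational and minimal rules -/

lemma Str.sat_eqRule {A : PropCat.{u, v} 𝓛} (S : Str Sg A) {P : Set (Assertion 𝓛 Sg)}
    {a : Assertion 𝓛 Sg} (h : EqRule P a) (hP : ∀ b ∈ P, S.Sat b) : S.Sat a := by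
  cases h with
  | refl M => exact rfl
  | symm M N => exact (hP (.eqn M N) rfl).symm
  | trans M N K => exact (hP (.eqn M N) (.inl rfl)).trans (hP (.eqn N K) (.inr rfl))
  | sub ρ hρ M M' N N' =>
    have h1 : S.term M = S.term M' := hP (.eqn M M') (.inl rfl)
    have h2 : S.term N = S.term N' := hP (.eqn N N') (.inr rfl)
    change S.term _ = S.term _
    rw [S.term_subst, S.term_subst, h2, S.sub_single]
    rw [S.term_subst, S.term_subst, h1]

lemma Str.sat_minRule {A : PropCat.{u, v} 𝓛} (S : Str Sg A) {P : Set (Assertion 𝓛 Sg)}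
    {a : Assertion 𝓛 Sg} (h : MinRule P a) (hP : ∀ b ∈ P, S.Sat b) : S.Sat a := by
  -- By associativity the two antecedents have the same product, not just comparable ones, so both
  -- directions of `⊗`-Ref follow without monotonicity of `⊗`. The next claim does the same for `e`
  -- by the unit law.
  have tens : ∀ {Γ : List Sg.Srt} (Φ Ψ : List (Formula 𝓛 Sg Γ)) (α β : Formula 𝓛 Sg Γ),
      A.tensorList _ ((Φ ++ α.tensor β :: Ψ).map S.formula) =
        A.tensorList _ ((Φ ++ α :: β :: Ψ).map S.formula) := by
    intro Γ Φ Ψ α β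
    rw [List.map_append, List.map_append, A.tensorList_append, A.tensorList_append]
    change A.conn _ _ ![_, A.conn _ _ ![S.formula (α.tensor β), A.tensorList _ _]] =
      A.conn _ _ ![_, A.conn _ _ ![S.formula α, A.conn _ _ ![S.formula β, A.tensorList _ _]]]
    rw [S.formula_tensor, A.tensor_assoc]
  have unit : ∀ {Γ : List Sg.Srt} (Φ Ψ : List (Formula 𝓛 Sg Γ)),
      A.tensorList _ ((Φ ++ Formula.unit :: Ψ).map S.formula) =
        A.tensorList _ ((Φ ++ Ψ).map S.formula) := by
    intro Γ Φ Ψ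
    rw [List.map_append, List.map_append, A.tensorList_append, A.tensorList_append]
    change A.conn _ _ ![_, A.conn _ _ ![S.formula .unit, A.tensorList _ _]] = _
    rw [S.formula_unit, A.unit_tensor]
  cases h with
  | ax φ => exact (S.sat_singleton φ φ).2 le_rfl
  | cut φ ψ θ =>
    exact (S.sat_singleton φ θ).2 (((S.sat_singleton φ ψ).1 (hP _ (.inl rfl))).trans
      ((S.sat_singleton ψ θ).1 (hP _ (.inr rfl))))
  | cwk σ Φ ψ => exact S.sat_subst (hP _ rfl) rfl
  | sub ρ hρ M M' Φ ψ =>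
    have h1 : S.term M = S.term M' := hP (.eqn M M') (.inl rfl)
    refine S.sat_subst (hP _ (.inr rfl)) (S.sub_single ?_)
    rw [S.term_subst, S.term_subst, h1]
  | quant_con q σ φ ψ =>
    -- The quantifier maps are not assumed monotone. The two premises together give an equality, to
    -- which any map may be applied; the same holds for connectives below.
    have h : S.formula φ = S.formula ψ := le_antisymm
      ((S.sat_singleton φ ψ).1 (hP _ (.inl rfl))) ((S.sat_singleton ψ φ).1 (hP _ (.inr rfl)))
    exact (S.sat_singleton _ _).2 (le_of_eq (congrArg (A.quant q _ (S.srt σ)) h))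
  | conn_cong c φ ψ =>
    have h : ∀ i, S.formula (φ i) = S.formula (ψ i) := fun i => le_antisymm
      ((S.sat_singleton _ _).1 (hP _ ⟨i, .inl rfl⟩)) ((S.sat_singleton _ _).1 (hP _ ⟨i, .inr rfl⟩))
    exact (S.sat_singleton _ _).2 (le_of_eq (congrArg (A.conn _ c) (funext h)))
  | tensor_down Φ Ψ α β θ => exact (tens Φ Ψ α β).le.trans (hP _ rfl)
  | tensor_up Φ Ψ α β θ => exact (tens Φ Ψ α β).ge.trans (hP _ rfl)
  | unit_down Φ Ψ θ => exact (unit Φ Ψ).ge.trans (hP _ rfl)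
  | unit_up Φ Ψ θ => exact (unit Φ Ψ).le.trans (hP _ rfl)

lemma Str.sat_baseRule {A : PropCat.{u, v} 𝓛} (S : Str Sg A) {P : Set (Assertion 𝓛 Sg)}
    {a : Assertion 𝓛 Sg} (h : BaseRule P a) (hP : ∀ b ∈ P, S.Sat b) : S.Sat a := by
  cases h with
  | eq h => exact S.sat_eqRule h hP
  | min h => exact S.sat_minRule h hP

/-! ## Sequents over the classifying prop-category -/

/-- The product `φ₁ ⊗ ⋯ ⊗ φₙ` of a list of formulas. -/
def Formula.tensorList {Γ : List Sg.Srt} (Φ : List (Formula 𝓛 Sg Γ)) : Formula 𝓛 Sg Γ :=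
  Φ.foldr Formula.tensor Formula.unit

lemma Formula.tensorList_subst {Γ Δ : List Sg.Srt} (Φ : List (Formula 𝓛 Sg Γ)) (s : Subst Γ Δ) :
    (Formula.tensorList Φ).subst s = Formula.tensorList (Φ.map (·.subst s)) := by
  induction Φ with
  | nil => exact Formula.unit_subst s
  | cons φ Φ ih =>
    exact (Formula.tensor_subst s φ (Formula.tensorList Φ)).trans
      (congrArg (Formula.tensor (φ.subst s)) ih)

/-! ### Antecedents folded into a single formula -/

lemma IsBaseTheory.tensor_iff {T : Theory 𝓛 Sg} (hT : IsBaseTheory T) {Γ : List Sg.Srt}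
    {Φ Ψ : List (Formula 𝓛 Sg Γ)} {α β θ : Formula 𝓛 Sg Γ} :
    .seq (Φ ++ α.tensor β :: Ψ) θ ∈ T ↔ .seq (Φ ++ α :: β :: Ψ) θ ∈ T :=
  ⟨fun h => hT _ _ (.min (.tensor_up Φ Ψ α β θ)) (Set.singleton_subset_iff.2 h),
    fun h => hT _ _ (.min (.tensor_down Φ Ψ α β θ)) (Set.singleton_subset_iff.2 h)⟩

lemma IsBaseTheory.unit_iff {T : Theory 𝓛 Sg} (hT : IsBaseTheory T) {Γ : List Sg.Srt}
    {Φ Ψ : List (Formula 𝓛 Sg Γ)} {θ : Formula 𝓛 Sg Γ} :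
    .seq (Φ ++ Formula.unit :: Ψ) θ ∈ T ↔ .seq (Φ ++ Ψ) θ ∈ T :=
  ⟨fun h => hT _ _ (.min (.unit_down Φ Ψ θ)) (Set.singleton_subset_iff.2 h),
    fun h => hT _ _ (.min (.unit_up Φ Ψ θ)) (Set.singleton_subset_iff.2 h)⟩

/-- `⊗`-Ref splits off the first factor of the product, which then joins the prefix. The prefix `Ψ`
therefore has to vary in the induction; the final `e` is removed by `e`-Ref. -/
lemma IsBaseTheory.append_tensorList_iff {T : Theory 𝓛 Sg} (hT : IsBaseTheory T)
    {Γ : List Sg.Srt} (Ψ Φ : List (Formula 𝓛 Sg Γ)) (θ : Formula 𝓛 Sg Γ) :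
    .seq (Ψ ++ [Formula.tensorList Φ]) θ ∈ T ↔ .seq (Ψ ++ Φ) θ ∈ T := by
  induction Φ generalizing Ψ with
  | nil => exact hT.unit_iff
  | cons φ Φ ih =>
    have h := ih (Ψ ++ [φ])
    rw [List.append_assoc, List.append_assoc] at h
    exact hT.tensor_iff.trans h

lemma IsBaseTheory.tensorList_iff {T : Theory 𝓛 Sg} (hT : IsBaseTheory T)
    {Γ : List Sg.Srt} (Φ : List (Formula 𝓛 Sg Γ)) (θ : Formula 𝓛 Sg Γ) :
    .seq [Formula.tensorList Φ] θ ∈ T ↔ .seq Φ θ ∈ T :=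
  hT.append_tensorList_iff [] Φ θ

lemma FormCls.tensorList_mk {T : Theory 𝓛 Sg} (hT : IsBaseTheory T) {Γ : List Sg.Srt}
    (Φ : List (Formula 𝓛 Sg Γ)) :
    (classifying hT).tensorList (⟨Γ⟩ : Cls hT) (Φ.map (FormCls.mk hT)) =
      FormCls.mk hT (Formula.tensorList Φ) := by
  induction Φ with
  | nil => exact FormCls.unit_mk hT Γ
  | cons φ Φ ih =>
    exact (congrArg (fun y => FormCls.conn hT Γ 𝓛.tensor ![FormCls.mk hT φ, y]) ih).trans
      (FormCls.tensor_mk hT φ _)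

/-- The order of `P_T` is defined by sequents with one antecedent. The rules for `⊗` and `e` make it
speak of all sequents. -/
lemma FormCls.tensorList_le_iff {T : Theory 𝓛 Sg} (hT : IsBaseTheory T) {Γ : List Sg.Srt}
    (Φ : List (Formula 𝓛 Sg Γ)) (θ : Formula 𝓛 Sg Γ) :
    (classifying hT).tensorList (⟨Γ⟩ : Cls hT) (Φ.map (FormCls.mk hT)) ≤ FormCls.mk hT θ ↔
      .seq Φ θ ∈ T := by
  rw [FormCls.tensorList_mk]
  exact hT.tensorList_iff Φ θ

lemma FormCls.exists_map_mk {T : Theory 𝓛 Sg} {hT : IsBaseTheory T} {Γ : List Sg.Srt}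
    (l : List (FormCls hT Γ)) : ∃ Φ : List (Formula 𝓛 Sg Γ), Φ.map (FormCls.mk hT) = l := by
  choose f hf using FormCls.exists_mk (hT := hT) (Γ := Γ)
  refine ⟨l.map f, ?_⟩
  rw [List.map_map]
  exact (List.map_congr_left fun x _ => hf x).trans l.map_id

/-! ### Substitution in sequents with several antecedents -/

lemma IsBaseTheory.subst_list {T : Theory 𝓛 Sg} (hT : IsBaseTheory T) {Γ Δ : List Sg.Srt}
    (s : Subst Γ Δ) {Φ : List (Formula 𝓛 Sg Γ)} {ψ : Formula 𝓛 Sg Γ} (h : .seq Φ ψ ∈ T) :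
    .seq (Φ.map (·.subst s)) (ψ.subst s) ∈ T := by
  rw [← hT.tensorList_iff] at h ⊢
  rw [← Formula.tensorList_subst]
  exact hT.subst_seq (fun σ v => hT.refl (s v)) h

lemma Formula.map_subst_comp {Γ Δ Ξ : List Sg.Srt} (s : Subst Γ Δ) (t : Subst Δ Ξ)
    (Φ : List (Formula 𝓛 Sg Γ)) :
    (Φ.map (·.subst s)).map (·.subst t) = Φ.map (·.subst (s.comp t)) := by
  rw [List.map_map]
  exact List.map_congr_left fun φ _ => φ.subst_comp s t

lemma Formula.map_subst_id {Γ : List Sg.Srt} (Φ : List (Formula 𝓛 Sg Γ)) :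
    Φ.map (·.subst (Subst.id Γ)) = Φ := by
  simp [Formula.subst_id]

/-- Invertible substitutions neither create nor destroy theorems. -/
lemma IsBaseTheory.subst_iff {T : Theory 𝓛 Sg} (hT : IsBaseTheory T) {Γ Δ : List Sg.Srt}
    {s : Subst Γ Δ} {t : Subst Δ Γ} (hst : s.comp t = Subst.id Γ) {Φ : List (Formula 𝓛 Sg Γ)}
    {ψ : Formula 𝓛 Sg Γ} : .seq (Φ.map (·.subst s)) (ψ.subst s) ∈ T ↔ .seq Φ ψ ∈ T := by
  -- Only the composite of `s` followed by `t` has to be the identity: applying `t` undoes `s`.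
  refine ⟨fun h => ?_, hT.subst_list s⟩
  have := hT.subst_list t h
  rwa [Formula.map_subst_comp, Formula.subst_comp, hst, Formula.map_subst_id,
    Formula.subst_id] at this

/-! ## The adjoint rules for contexts -/

lemma Logic.IsTheory.closed {L : Logic 𝓛} {T : Theory 𝓛 Sg} (hT : L.IsTheory T)
    {P : Set (Assertion 𝓛 Sg)} {a : Assertion 𝓛 Sg} (h : L.Rule P a) (hP : P ⊆ T) : a ∈ T := by
  rw [← hT]
  exact .infer h fun b hb => .hyp (hP hb)

/-- The newest variable of `[Γ, Γ']` carries the innermost quantifier of the block. One use of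
`∃`-Adj over `[Γ, Γ']`, with side formulas weakened from `Γ`, removes it, and the induction
hypothesis handles the rest of `Γ'`. -/
lemma Logic.IsTheory.exAdj_iff {L : Logic 𝓛} {T : Theory 𝓛 Sg} (hT : L.IsTheory T)
    (hL : L.exAdj) {Γ : List Sg.Srt} (Γ' : List Sg.Srt) (Φ : List (Formula 𝓛 Sg Γ))
    (ψ : Formula 𝓛 Sg (Γ' ++ Γ)) (θ : Formula 𝓛 Sg Γ) :
    .seq (Φ.map (·.subst (Ren.sub (Var.inr Γ'))) ++ [ψ]) (θ.subst (Ren.sub (Var.inr Γ'))) ∈ T ↔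
      .seq (Φ ++ [ψ.quantCtx .ex Γ']) θ ∈ T := by
  induction Γ' with
  | nil =>
    -- Weakening along the empty context computes to the identity substitution. Generalizing `ψ`
    -- lets its context `[] ++ Γ` be restated as `Γ`.
    revert ψ
    change ∀ ψ : Formula 𝓛 Sg Γ,
      .seq (Φ.map (·.subst (Subst.id Γ)) ++ [ψ]) (θ.subst (Subst.id Γ)) ∈ T ↔ _
    intro ψ
    rw [Formula.map_subst_id, Formula.subst_id]; rfl
  | cons σ Γ' ih =>
    refine Iff.trans ?_ (ih (.quant .ex σ ψ))
    have e : (Ren.sub (Var.inr (σ :: Γ')) : Subst Γ (σ :: (Γ' ++ Γ))) =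
      Subst.comp (Ren.sub (Var.inr Γ')) (Subst.wk σ) := rfl
    rw [e, ← Formula.map_subst_comp, ← Formula.subst_comp]
    exact ⟨fun h => hT.closed (.exAdj hL (.down _ ψ _)) (Set.singleton_subset_iff.2 h),
      fun h => hT.closed (.exAdj hL (.up _ ψ _)) (Set.singleton_subset_iff.2 h)⟩

lemma Logic.IsTheory.allAdj_iff {L : Logic 𝓛} {T : Theory 𝓛 Sg} (hT : L.IsTheory T)
    (hL : L.allAdj) {Γ : List Sg.Srt} (Γ' : List Sg.Srt) (Φ : List (Formula 𝓛 Sg Γ))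
    (ψ : Formula 𝓛 Sg (Γ' ++ Γ)) :
    .seq (Φ.map (·.subst (Ren.sub (Var.inr Γ')))) ψ ∈ T ↔
      .seq Φ (ψ.quantCtx .all Γ') ∈ T := by
  induction Γ' with
  | nil =>
    change .seq (Φ.map (·.subst (Subst.id Γ))) ψ ∈ T ↔ _
    rw [Formula.map_subst_id]; rfl
  | cons σ Γ' ih =>
    refine Iff.trans ?_ (ih (.quant .all σ ψ))
    have e : (Ren.sub (Var.inr (σ :: Γ')) : Subst Γ (σ :: (Γ' ++ Γ))) =
      Subst.comp (Ren.sub (Var.inr Γ')) (Subst.wk σ) := rfl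
    rw [e, ← Formula.map_subst_comp]
    exact ⟨fun h => hT.closed (.allAdj hL (.down _ ψ)) (Set.singleton_subset_iff.2 h),
      fun h => hT.closed (.allAdj hL (.up _ ψ)) (Set.singleton_subset_iff.2 h)⟩

/-- Every variable can be moved to the last position of its context. -/
lemma Var.exists_move {S : Type u} {Δ : List S} {σ : S} (w : Var Δ σ) :
    ∃ (Ξ : List S) (f : Ren Δ (σ :: Ξ)) (g : Ren (σ :: Ξ) Δ),
      (∀ τ (v : Var Δ τ), g (f v) = v) ∧ (∀ τ (v : Var (σ :: Ξ) τ), f (g v) = v) ∧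
        f w = .zero := by
  induction w with
  | @zero Γ σ => exact ⟨Γ, fun _ v => v, fun _ v => v, fun _ _ => rfl, fun _ _ => rfl, rfl⟩
  | @succ Γ σ τ w ih =>
    obtain ⟨Ξ, f, g, hgf, hfg, hw⟩ := ih
    -- The variable of sort `σ` stays last, and a free slot for the newest variable, of sort `τ`, is
    -- opened just before it. `f'` sends that variable to the slot and treats all others by `f`
    -- followed by `swap`; `g'` reverses this.
    let swap : Ren (σ :: Ξ) (σ :: τ :: Ξ) := Var.cons .zero fun _ v => v.succ.succ
    let f' : Ren (τ :: Γ) (σ :: τ :: Ξ) := Var.cons (.succ .zero) fun _ v => swap (f v)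
    let g' : Ren (σ :: τ :: Ξ) (τ :: Γ) :=
      Var.cons (g .zero).succ (Var.cons .zero fun _ v => (g v.succ).succ)
    have hswap : ∀ ρ (v : Var (σ :: Ξ) ρ), g' (swap v) = (g v).succ := by
      intro ρ v; cases v <;> rfl
    refine ⟨τ :: Ξ, f', g', ?_, ?_, ?_⟩
    · intro ρ v
      cases v with
      | zero => rfl
      | succ v => exact (hswap ρ (f v)).trans (congrArg Var.succ (hgf ρ v))
    · intro ρ v
      cases v with
      | zero => exact congrArg (fun x => swap x) (hfg _ .zero)
      | succ v =>
        cases v with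
        | zero => rfl
        | succ v => exact congrArg (fun x => swap x) (hfg _ v.succ)
    · exact congrArg (fun x => swap x) hw

/-- The rule `=`-Adj for an arbitrary variable of the context. -/
lemma Logic.IsTheory.eqAdj_var_iff {L : Logic 𝓛} {T : Theory 𝓛 Sg} (hT : L.IsTheory T)
    (hL : L.eqAdj) {Δ : List Sg.Srt} {σ : Sg.Srt} (w : Var Δ σ) (Φ : List (Formula 𝓛 Sg Δ))
    (ψ : Formula 𝓛 Sg (σ :: Δ)) :
    .seq (Φ.map (·.subst (Subst.wk σ)) ++ [.eq (.var w.succ) (.var .zero)]) ψ ∈ T ↔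
      .seq Φ (ψ.subst (Var.cons (.var w) (Subst.id Δ))) ∈ T := by
  obtain ⟨Ξ, f, g, hgf, hfg, hw⟩ := w.exists_move
  have hs : Subst.comp (Ren.sub f) (Ren.sub g) = Subst.id (Sg := Sg) Δ := by
    funext τ v; exact congrArg Term.var (hgf τ v)
  have hs' : ((Ren.sub f).lift σ).comp ((Ren.sub g).lift σ) = Subst.id (Sg := Sg) (σ :: Δ) := by
    rw [Subst.lift_comp, hs, Subst.lift_id]
  -- Both sequents are transported along the renaming that makes `w` the last variable, since the
  -- primitive rule applies only there.
  rw [← hT.base.subst_iff hs', ← hT.base.subst_iff hs, List.map_append]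
  have e1 : (Φ.map (·.subst (Subst.wk σ))).map (·.subst ((Ren.sub f).lift σ)) =
      (Φ.map (·.subst (Ren.sub f))).map (·.subst (Subst.wk σ)) := by
    rw [Formula.map_subst_comp, Formula.map_subst_comp]; rfl
  have e2 : [Formula.eq (𝓛 := 𝓛) (Term.var (Sg := Sg) w.succ) (.var .zero)].map
      (·.subst ((Ren.sub f).lift σ)) = [.eq (.var (.succ .zero)) (.var .zero)] := by
    change [Formula.eq (Term.var (f w).succ) _] = _
    rw [hw]; rfl
  -- Identifying the fresh variable with `w` and then permuting the context agrees with permuting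
  -- first and then identifying the two last variables.
  have e3 : (ψ.subst (Var.cons (.var w) (Subst.id Δ))).subst (Ren.sub f) =
      (ψ.subst ((Ren.sub f).lift σ)).subst (Subst.single (σ :: Ξ) [] (.var .zero)) := by
    rw [Formula.subst_comp, Formula.subst_comp]
    congr 1
    funext τ v
    cases v with
    | zero => exact congrArg Term.var hw
    | succ v => rfl
  rw [e1, e2, e3]
  exact ⟨fun h => hT.closed (.eqAdj hL (.up _ _)) (Set.singleton_subset_iff.2 h),
    fun h => hT.closed (.eqAdj hL (.down _ _)) (Set.singleton_subset_iff.2 h)⟩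

/-- The rule `=`-Adj for a tuple of variables of the context. -/
lemma Logic.IsTheory.eqAdj_iff {L : Logic 𝓛} {T : Theory 𝓛 Sg} (hT : L.IsTheory T)
    (hL : L.eqAdj) {Δ : List Sg.Srt} {Γ' : List Sg.Srt} (ρ : Ren Γ' Δ)
    (Φ : List (Formula 𝓛 Sg Δ)) (ψ : Formula 𝓛 Sg (Γ' ++ Δ)) :
    .seq (Φ.map (·.subst (Ren.sub (Var.inr Γ'))) ++
        [.eqTuple (Ren.sub fun _ v => Var.inr Γ' (ρ v)) (Ren.sub (Var.inl Δ))]) ψ ∈ T ↔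
      .seq Φ (ψ.subst (Var.append (Ren.sub ρ) (Subst.id Δ))) ∈ T := by
  induction Γ' with
  | nil =>
    refine hT.base.unit_iff.trans ?_
    revert ψ
    change ∀ ψ : Formula 𝓛 Sg Δ,
      .seq (Φ.map (·.subst (Subst.id Δ)) ++ []) ψ ∈ T ↔ .seq Φ (ψ.subst (Subst.id Δ)) ∈ T
    intro ψ
    rw [Formula.map_subst_id, Formula.subst_id, List.append_nil]
  | cons σ Γ' ih =>
    -- The induction hypothesis is applied after replacing the newest copy by its original. That
    -- replacement is then traded for an equation; the original lies behind the copies in `Γ'`,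
    -- which is why the version for an arbitrary variable is needed.
    have h1 := ih (fun _ v => ρ v.succ)
      (ψ.subst (Var.cons (.var (Var.inr Γ' (ρ .zero))) (Subst.id (Γ' ++ Δ))))
    rw [← hT.eqAdj_var_iff hL, List.map_append, Formula.map_subst_comp, List.map_singleton,
      Formula.eqTuple_subst, Formula.subst_comp, List.append_assoc] at h1
    -- The equality formula of a nonempty tuple is a product whose last factor is the newest
    -- equation; `⊗`-Ref separates the two.
    refine Iff.trans (hT.base.tensor_iff (Ψ := [])) (h1.trans ?_)
    have e : (Subst.comp (Var.cons (.var (Var.inr Γ' (ρ .zero))) (Subst.id (Γ' ++ Δ)))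
        (Var.append (Ren.sub fun _ v => ρ v.succ) (Subst.id Δ)) :
          Subst (Sg := Sg) (σ :: (Γ' ++ Δ)) Δ) =
        Var.append (Γ' := σ :: Γ') (Ren.sub ρ) (Subst.id Δ) := by
      funext τ v
      cases v with
      | zero => exact Var.append_inr _ _ _
      | succ v => rfl
    rw [e]

/-! ## Soundness -/

/-- This is the bridge between semantics and syntax: any choice of representatives converts
satisfaction in the classifying prop-category into membership in `T`. Every optional rule is
verified through it. -/
lemma Str.sat_seq_iff {Sg' : Signature.{u}} {T : Theory 𝓛 Sg'} {hT : IsBaseTheory T}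
    (S : Str Sg (classifying hT)) {Γ : List Sg.Srt} {Φ : List (Formula 𝓛 Sg Γ)}
    {ψ : Formula 𝓛 Sg Γ}
    {Φ' : List (Formula 𝓛 Sg' (((classifying hT).ctx S.srt Γ : Cls hT).ctx))}
    {ψ' : Formula 𝓛 Sg' (((classifying hT).ctx S.srt Γ : Cls hT).ctx)}
    (hΦ : Φ'.map (FormCls.mk hT) = Φ.map S.formula) (hψ : FormCls.mk hT ψ' = S.formula ψ) :
    S.Sat (.seq Φ ψ) ↔ .seq Φ' ψ' ∈ T := by
  refine Iff.trans ?_ (FormCls.tensorList_le_iff hT Φ' ψ')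
  exact (iff_of_eq (congrArg₂ (fun l x =>
    (classifying hT).tensorList ((classifying hT).ctx S.srt Γ) l ≤ x) hΦ hψ)).symm

/-- The first projection in the classifying category is weakening by the entire context that
interprets `σ`. -/
lemma Str.map_formula_wk {Sg' : Signature.{u}} {T : Theory 𝓛 Sg'} {hT : IsBaseTheory T}
    (S : Str Sg (classifying hT)) {Γ : List Sg.Srt} (σ : Sg.Srt) {φ : Formula 𝓛 Sg Γ}
    {φ' : Formula 𝓛 Sg' (((classifying hT).ctx S.srt Γ : Cls hT).ctx)}
    (h : FormCls.mk hT φ' = S.formula φ) :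
    FormCls.mk hT (φ'.subst (Ren.sub (Var.inr (S.srt σ : Cls hT).ctx))) =
      S.formula (φ.subst (Subst.wk σ)) := by
  rw [S.formula_subst, S.sub_wk, ← h]
  rfl

lemma FormCls.map_pull {T : Theory 𝓛 Sg} (hT : IsBaseTheory T) {Γ Δ : List Sg.Srt}
    (s : Subst Γ Δ) (Φ : List (Formula 𝓛 Sg Γ)) :
    (Φ.map (·.subst s)).map (FormCls.mk hT) =
      (Φ.map (FormCls.mk hT)).map (FormCls.pull hT (Cls.homMk hT s)) := by
  rw [List.map_map, List.map_map]
  rfl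

lemma Str.map_list_wk {Sg' : Signature.{u}} {T : Theory 𝓛 Sg'} {hT : IsBaseTheory T}
    (S : Str Sg (classifying hT)) {Γ : List Sg.Srt} (σ : Sg.Srt) {Φ : List (Formula 𝓛 Sg Γ)}
    {Φ' : List (Formula 𝓛 Sg' (((classifying hT).ctx S.srt Γ : Cls hT).ctx))}
    (h : Φ'.map (FormCls.mk hT) = Φ.map S.formula) :
    (Φ'.map (·.subst (Ren.sub (Var.inr (S.srt σ : Cls hT).ctx)))).map (FormCls.mk hT) =
      (Φ.map (·.subst (Subst.wk σ))).map S.formula := by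
  rw [S.map_formula_subst, S.sub_wk]
  exact (FormCls.map_pull hT _ Φ').trans (congrArg (List.map _) h)

lemma Str.formula_quant {Sg' : Signature.{u}} {T : Theory 𝓛 Sg'} {hT : IsBaseTheory T}
    (S : Str Sg (classifying hT)) {Γ : List Sg.Srt} (q : Quantifier) (σ : Sg.Srt)
    {ψ : Formula 𝓛 Sg (σ :: Γ)} {ψ' : Formula 𝓛 Sg' ((S.srt σ : Cls hT).ctx ++
      ((classifying hT).ctx S.srt Γ : Cls hT).ctx)}
    (h : FormCls.mk hT ψ' = S.formula ψ) :
    FormCls.mk hT (ψ'.quantCtx q (S.srt σ : Cls hT).ctx) = S.formula (.quant q σ ψ) :=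
  (FormCls.quant_mk hT q ψ').symm.trans (congrArg ((classifying hT).quant q _ (S.srt σ)) h)

lemma Str.exists_formula {Sg' : Signature.{u}} {T : Theory 𝓛 Sg'} {hT : IsBaseTheory T}
    (S : Str Sg (classifying hT)) {Γ : List Sg.Srt} (φ : Formula 𝓛 Sg Γ) :
    ∃ φ' : Formula 𝓛 Sg' (((classifying hT).ctx S.srt Γ : Cls hT).ctx),
      FormCls.mk hT φ' = S.formula φ :=
  FormCls.exists_mk _

lemma Str.exists_list {Sg' : Signature.{u}} {T : Theory 𝓛 Sg'} {hT : IsBaseTheory T}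
    (S : Str Sg (classifying hT)) {Γ : List Sg.Srt} (Φ : List (Formula 𝓛 Sg Γ)) :
    ∃ Φ' : List (Formula 𝓛 Sg' (((classifying hT).ctx S.srt Γ : Cls hT).ctx)),
      Φ'.map (FormCls.mk hT) = Φ.map S.formula :=
  FormCls.exists_map_mk _

lemma map_append_singleton {α β γ : Type*} {f : α → γ} {g : β → γ} {l : List α} {m : List β}
    {a : α} {b : β} (h : l.map f = m.map g) (hab : f a = g b) :
    (l ++ [a]).map f = (m ++ [b]).map g := by
  rw [List.map_append, List.map_append, h, List.map_singleton, List.map_singleton, hab]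

/-! ### The adjoint rules over a classifying prop-category -/

lemma Str.sat_exAdj {Sg' : Signature.{u}} {L : Logic 𝓛} {T : Theory 𝓛 Sg'} (hT : L.IsTheory T)
    (hL : L.exAdj) (S : Str Sg (classifying hT.base)) {P : Set (Assertion 𝓛 Sg)}
    {a : Assertion 𝓛 Sg} (h : ExAdj P a) (hP : ∀ b ∈ P, S.Sat b) : S.Sat a := by
  have key : ∀ {Γ : List Sg.Srt} {σ : Sg.Srt} (Φ : List (Formula 𝓛 Sg Γ))
      (ψ : Formula 𝓛 Sg (σ :: Γ)) (θ : Formula 𝓛 Sg Γ),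
      S.Sat (.seq (Φ.map (·.subst (Subst.wk σ)) ++ [ψ]) (θ.subst (Subst.wk σ))) ↔
        S.Sat (.seq (Φ ++ [.quant .ex σ ψ]) θ) := by
    intro Γ σ Φ ψ θ
    obtain ⟨Φ', hΦ⟩ := S.exists_list Φ
    obtain ⟨ψ', hψ⟩ := S.exists_formula ψ
    obtain ⟨θ', hθ⟩ := S.exists_formula θ
    rw [S.sat_seq_iff (Γ := _ :: _) (map_append_singleton (S.map_list_wk σ hΦ) hψ) (S.map_formula_wk σ hθ),
      S.sat_seq_iff (map_append_singleton hΦ (S.formula_quant .ex σ hψ)) hθ]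
    exact hT.exAdj_iff hL _ Φ' ψ' θ'
  cases h with
  | down Φ ψ θ => exact (key Φ ψ θ).1 (hP _ rfl)
  | up Φ ψ θ => exact (key Φ ψ θ).2 (hP _ rfl)

lemma Str.sat_allAdj {Sg' : Signature.{u}} {L : Logic 𝓛} {T : Theory 𝓛 Sg'} (hT : L.IsTheory T)
    (hL : L.allAdj) (S : Str Sg (classifying hT.base)) {P : Set (Assertion 𝓛 Sg)}
    {a : Assertion 𝓛 Sg} (h : AllAdj P a) (hP : ∀ b ∈ P, S.Sat b) : S.Sat a := by
  have key : ∀ {Γ : List Sg.Srt} {σ : Sg.Srt} (Φ : List (Formula 𝓛 Sg Γ))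
      (ψ : Formula 𝓛 Sg (σ :: Γ)),
      S.Sat (.seq (Φ.map (·.subst (Subst.wk σ))) ψ) ↔ S.Sat (.seq Φ (.quant .all σ ψ)) := by
    intro Γ σ Φ ψ
    obtain ⟨Φ', hΦ⟩ := S.exists_list Φ
    obtain ⟨ψ', hψ⟩ := S.exists_formula ψ
    rw [S.sat_seq_iff (Γ := _ :: _) (S.map_list_wk σ hΦ) hψ, S.sat_seq_iff hΦ (S.formula_quant .all σ hψ)]
    exact hT.allAdj_iff hL _ Φ' ψ'
  cases h with
  | down Φ ψ => exact (key Φ ψ).1 (hP _ rfl)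
  | up Φ ψ => exact (key Φ ψ).2 (hP _ rfl)

lemma Str.sat_eqAdj {Sg' : Signature.{u}} {L : Logic 𝓛} {T : Theory 𝓛 Sg'} (hT : L.IsTheory T)
    (hL : L.eqAdj) (S : Str Sg (classifying hT.base)) {P : Set (Assertion 𝓛 Sg)}
    {a : Assertion 𝓛 Sg} (h : EqAdj P a) (hP : ∀ b ∈ P, S.Sat b) : S.Sat a := by
  have key : ∀ {Γ : List Sg.Srt} {σ : Sg.Srt} (Φ : List (Formula 𝓛 Sg (σ :: Γ)))
      (ψ : Formula 𝓛 Sg (σ :: σ :: Γ)),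
      S.Sat (.seq (Φ.map (·.subst (Subst.wk σ)) ++ [.eq (.var (.succ .zero)) (.var .zero)]) ψ) ↔
        S.Sat (.seq Φ (ψ.subst (Subst.single (σ :: Γ) [] (.var .zero)))) := by
    intro Γ σ Φ ψ
    obtain ⟨Φ', hΦ⟩ := S.exists_list Φ
    obtain ⟨ψ', hψ⟩ := S.exists_formula ψ
    let c : List Sg'.Srt := (S.srt σ : Cls hT.base).ctx
    let b : List Sg'.Srt := ((classifying hT.base).ctx S.srt Γ : Cls hT.base).ctx
    -- The equation between the two last variables denotes a reindexing of `Eq_c`, where `c`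
    -- interprets `σ`. Its representative is therefore the product of equations between two copies
    -- of `c`.
    have e1 : FormCls.mk hT.base (.eqTuple (Ren.sub fun _ v => Var.inr c (Var.inl b v))
        (Ren.sub (Var.inl (c ++ b)))) =
        S.formula (Γ := σ :: σ :: Γ) (.eq (.var (.succ .zero)) (.var .zero)) := by
      rw [← FormCls.pull_eq]
      exact congrArg (fun f => FormCls.pull hT.base f (FormCls.eq hT.base c))
        (Cls.lift_mk hT.base (Ren.sub fun _ v => Var.inr c (Var.inl b v))
          (Ren.sub (Var.inl (c ++ b)))).symm
    have e2 : FormCls.mk hT.base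
        (ψ'.subst (Var.append (Ren.sub (Var.inl b)) (Subst.id (c ++ b)))) =
        S.formula (ψ.subst (Subst.single (σ :: Γ) [] (.var .zero))) := by
      -- Identifying the two last variables denotes the pairing of the identity with the projection
      -- to `c`, so on representatives every variable of the second copy of `c` is replaced by its
      -- original.
      have hs : S.sub (Subst.single (σ :: Γ) [] (.var .zero)) =
          lift (S.sub (Subst.id (σ :: Γ))) (CartesianMonoidalCategory.snd _ _) := rfl
      rw [S.formula_subst, hs, S.sub_id, ← hψ]
      exact congrArg (fun f => FormCls.pull hT.base f (FormCls.mk hT.base ψ'))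
        (Cls.lift_mk hT.base (Subst.id (c ++ b)) (Ren.sub (Var.inl b))).symm
    rw [S.sat_seq_iff (Γ := _ :: _) (map_append_singleton (S.map_list_wk σ hΦ) e1) hψ, S.sat_seq_iff hΦ e2]
    exact hT.eqAdj_iff hL _ Φ' ψ'
  cases h with
  | down Φ ψ => exact (key Φ ψ).2 (hP _ rfl)
  | up Φ ψ => exact (key Φ ψ).1 (hP _ rfl)

/-! ### Propositional rules over a classifying prop-category -/

lemma Str.formula_inst {Sg' : Signature.{u}} {T : Theory 𝓛 Sg'} {hT : IsBaseTheory T}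
    (S : Str Sg (classifying hT)) {Γ : List Sg.Srt} {φ : ℕ → Formula 𝓛 Sg Γ}
    {φ' : ℕ → Formula 𝓛 Sg' (((classifying hT).ctx S.srt Γ : Cls hT).ctx)}
    (h : ∀ i, FormCls.mk hT (φ' i) = S.formula (φ i)) (m : MetaFormula 𝓛) :
    FormCls.mk hT (m.inst φ') = S.formula (m.inst φ) := by
  induction m with
  | var i => exact h i
  | conn c m ih =>
    exact (FormCls.conn_mk hT c _).symm.trans
      (congrArg ((classifying hT).conn _ c) (funext ih))

lemma Str.sat_inst_iff {Sg' : Signature.{u}} {T : Theory 𝓛 Sg'} {hT : IsBaseTheory T}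
    (S : Str Sg (classifying hT)) {Γ : List Sg.Srt} {φ : ℕ → Formula 𝓛 Sg Γ}
    {φ' : ℕ → Formula 𝓛 Sg' (((classifying hT).ctx S.srt Γ : Cls hT).ctx)}
    (hφ : ∀ i, FormCls.mk hT (φ' i) = S.formula (φ i)) {Φ : ℕ → List (Formula 𝓛 Sg Γ)}
    {Φ' : ℕ → List (Formula 𝓛 Sg' (((classifying hT).ctx S.srt Γ : Cls hT).ctx))}
    (hΦ : ∀ i, (Φ' i).map (FormCls.mk hT) = (Φ i).map S.formula) (s : MetaSequent 𝓛) :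
    S.Sat (s.inst φ Φ) ↔ s.inst φ' Φ' ∈ T := by
  refine S.sat_seq_iff ?_ (S.formula_inst hφ _)
  rw [List.map_flatMap, List.map_flatMap]
  refine congrArg (fun f => List.flatMap f s.antecedent) (funext fun i => ?_)
  cases i with
  | formula m => exact congrArg (fun x => [x]) (S.formula_inst hφ m)
  | list i => exact hΦ i

lemma Str.sat_rule {Sg' : Signature.{u}} {L : Logic 𝓛} {T : Theory 𝓛 Sg'} (hT : L.IsTheory T)
    (S : Str Sg (classifying hT.base)) {P : Set (Assertion 𝓛 Sg)}
    {a : Assertion 𝓛 Sg} (h : L.Rule P a) (hP : ∀ b ∈ P, S.Sat b) : S.Sat a := by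
  cases h with
  | base h => exact S.sat_baseRule h hP
  | eqAdj hL h => exact S.sat_eqAdj hT hL h hP
  | exAdj hL h => exact S.sat_exAdj hT hL h hP
  | allAdj hL h => exact S.sat_allAdj hT hL h hP
  | prop hr φ Φ =>
    -- Representatives are fixed once for each metavariable. All premises and the conclusion then
    -- translate simultaneously into one instance of the same rule over the signature of the theory.
    choose φ' hφ using fun i => S.exists_formula (φ i)
    choose Φ' hΦ using fun i => S.exists_list (Φ i)
    rw [S.sat_inst_iff hφ hΦ]
    refine hT.closed (.prop hr φ' Φ') ?_
    rintro _ ⟨s, hs, rfl⟩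
    exact (S.sat_inst_iff hφ hΦ s).1 (hP _ ⟨s, hs, rfl⟩)

/-- Soundness: the theory of a structure in a classifying prop-category is closed under
derivations. -/
theorem Str.sat_derivable {Sg' : Signature.{u}} {L : Logic 𝓛} {T' : Theory 𝓛 Sg'}
    (hT' : L.IsTheory T') (S : Str Sg (classifying hT'.base)) {T : Theory 𝓛 Sg}
    (hS : S.IsModel T) {a : Assertion 𝓛 Sg} (h : L.Derivable T a) : S.Sat a := by
  induction h with
  | hyp h => exact hS h
  | infer h _ ih => exact S.sat_rule hT' h ih

/-! ## The generic model and completeness -/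

lemma Logic.isTheory_closure (L : Logic 𝓛) (T : Theory 𝓛 Sg) : L.IsTheory (L.closure T) := by
  refine Set.Subset.antisymm ?_ fun a h => .hyp h
  suffices ∀ a, L.Derivable (L.closure T) a → L.Derivable T a from this
  intro a h
  induction h with
  | hyp h => exact h
  | infer h _ ih => exact .infer h ih

/-- The interpretation of a sort in the generic structure: the context of one variable. -/
noncomputable def Cls.ofSort {T : Theory 𝓛 Sg} (hT : IsBaseTheory T) (σ : Sg.Srt) : (classifying hT).C :=
  (⟨[σ]⟩ : Cls hT)

/-- The context that interprets `Γ` in the generic structure. -/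
noncomputable def Cls.genCtx {T : Theory 𝓛 Sg} (hT : IsBaseTheory T) (Γ : List Sg.Srt) : List Sg.Srt :=
  ((classifying hT).ctx (Cls.ofSort hT) Γ : Cls hT).ctx

/-- The variables of `Γ` as variables of the context that interprets `Γ`. -/
noncomputable def Cls.toGen {T : Theory 𝓛 Sg} (hT : IsBaseTheory T) :
    {Γ : List Sg.Srt} → Ren Γ (Cls.genCtx hT Γ)
  | _ :: _, _, .zero => .zero
  | _ :: _, _, .succ v => (Cls.toGen hT v).succ

/-- The context interpreting `Γ` is rebuilt from one-variable contexts and agrees with `Γ` only by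
induction, so expressions are carried back by a renaming. A one-sided inverse is enough to reflect
derivability. -/
lemma Cls.exists_ofGen {T : Theory 𝓛 Sg} (hT : IsBaseTheory T) (Γ : List Sg.Srt) :
    ∃ g : Ren (Cls.genCtx hT Γ) Γ, ∀ σ (v : Var Γ σ), g (Cls.toGen hT v) = v := by
  induction Γ with
  | nil => exact ⟨fun _ v => v, fun _ v => nomatch v⟩
  | cons σ Γ ih =>
    obtain ⟨g, hg⟩ := ih
    refine ⟨Var.cons .zero fun _ v => (g v).succ, fun τ v => ?_⟩
    cases v with
    | zero => rfl
    | succ v => exact congrArg Var.succ (hg τ v)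

/-- The substitution that replaces the variables of `Γ` by those of its interpretation. -/
noncomputable def Cls.genSub {T : Theory 𝓛 Sg} (hT : IsBaseTheory T) (Γ : List Sg.Srt) :
    Subst Γ (Cls.genCtx hT Γ) :=
  Ren.sub (Cls.toGen hT)

lemma Cls.genSub_cons {T : Theory 𝓛 Sg} (hT : IsBaseTheory T) (σ : Sg.Srt) (Γ : List Sg.Srt) :
    Cls.genSub hT (σ :: Γ) = (Cls.genSub hT Γ).lift σ := by
  funext τ v
  cases v <;> rfl

lemma Cls.exists_genSub_comp {T : Theory 𝓛 Sg} (hT : IsBaseTheory T) (Γ : List Sg.Srt) :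
    ∃ t : Subst (Cls.genCtx hT Γ) Γ, (Cls.genSub hT Γ).comp t = Subst.id Γ := by
  obtain ⟨g, hg⟩ := Cls.exists_ofGen hT Γ
  exact ⟨Ren.sub g, by funext σ v; exact congrArg Term.var (hg σ v)⟩

/-- The tuple consisting of one term. -/
def Subst.one {Γ : List Sg.Srt} {τ : Sg.Srt} (M : Term Sg Γ τ) : Subst [τ] Γ :=
  Var.cons M fun _ v => nomatch v

/-- The generic structure in a classifying prop-category. -/
noncomputable def genericStr {T : Theory 𝓛 Sg} (hT : IsBaseTheory T) :
    Str Sg (classifying hT) where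
  srt := Cls.ofSort hT
  fn f := Cls.homMk hT (Subst.one (.app f (Cls.genSub hT (Sg.dom f))))
  rel R := FormCls.mk hT (.rel R (Cls.genSub hT (Sg.ar R)))

/-! ### Interpretation in the generic structure -/

/-- Tupling in the classifying category concatenates one-term tuples. The resulting substitution is
described by its values at the variables `Cls.toGen`, which are those occurring in the generic
function and relation symbols. -/
lemma genericStr_tuple {T : Theory 𝓛 Sg} (hT : IsBaseTheory T) {Δ : List Sg.Srt} :
    ∀ {Γ : List Sg.Srt} (s : Subst Γ Δ), ∃ r : Subst (Cls.genCtx hT Γ) Δ,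
      (classifying hT).tuple (Cls.ofSort hT) (X := (⟨Δ⟩ : Cls hT))
        (fun _ v => Cls.homMk hT (Subst.one (s v))) = Cls.homMk hT r ∧
      ∀ σ (v : Var Γ σ), r (Cls.toGen hT v) = s v
  | [], _ => ⟨(fun _ v => nomatch v), toUnit_unique _ _, fun _ v => nomatch v⟩
  | σ :: Γ, s => by
    obtain ⟨r, hr, h⟩ := genericStr_tuple hT fun _ v => s v.succ
    refine ⟨Var.append (Subst.one (s .zero)) r, ?_, fun τ v => ?_⟩
    · exact (congrArg (fun f => lift f (Cls.homMk hT (Subst.one (s .zero)))) hr).trans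
        (Cls.lift_mk hT r (Subst.one (s .zero)))
    · cases v with
      | zero => rfl
      | succ v => exact h τ v

lemma genericStr_term {T : Theory 𝓛 Sg} (hT : IsBaseTheory T) {Γ : List Sg.Srt} {τ : Sg.Srt}
    (M : Term Sg Γ τ) :
    (genericStr hT).term M = Cls.homMk hT (Subst.one (M.subst (Cls.genSub hT Γ))) := by
  induction M with
  | var v =>
    change (classifying hT).proj (Cls.ofSort hT) v = Cls.homMk hT (Subst.one (.var (Cls.toGen hT v)))
    induction v with
    | zero =>
      change Cls.homMk hT _ = _
      congr 1
      funext τ v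
      cases v with
      | zero => rfl
      | succ v => cases v
    | @succ Γ σ τ v ih =>
      change CartesianMonoidalCategory.fst _ _ ≫ (classifying hT).proj (Cls.ofSort hT) v = _
      rw [ih]
      change Cls.homMk hT _ = _
      congr 1
      funext τ v
      cases v with
      | zero => rfl
      | succ v => cases v
  | app f M ih =>
    obtain ⟨r, hr, h⟩ := genericStr_tuple hT fun _ v => (M v).subst (Cls.genSub hT Γ)
    change (classifying hT).tuple (Cls.ofSort hT) (fun _ v => (genericStr hT).term (M v)) ≫
      Cls.homMk hT _ = _
    simp only [ih]
    -- The generic interpretation of `f` is `f` applied to variables, and composition substitutes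
    -- the interpreted arguments for these.
    refine (congrArg (fun t => t ≫ Cls.homMk hT
      (Subst.one (.app f (Cls.genSub hT (Sg.dom f))))) hr).trans ?_
    rw [Cls.homMk_comp]
    congr 1
    funext τ v
    cases v with
    | zero => exact congrArg (Term.app f) (by funext σ v; exact h σ v)
    | succ v => cases v

lemma genericStr_formula {T : Theory 𝓛 Sg} (hT : IsBaseTheory T) {Γ : List Sg.Srt}
    (φ : Formula 𝓛 Sg Γ) :
    (genericStr hT).formula φ = FormCls.mk hT (φ.subst (Cls.genSub hT Γ)) := by
  induction φ with
  | @rel Γ R M =>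
    obtain ⟨r, hr, h⟩ := genericStr_tuple hT (M.comp (Cls.genSub hT Γ))
    simp only [Str.formula, genericStr_term]
    refine (congrArg (fun f => FormCls.pull hT f
      (FormCls.mk hT (.rel R (Cls.genSub hT (Sg.ar R))))) hr).trans ?_
    rw [FormCls.pull_mk]
    exact congrArg (fun s => FormCls.mk hT (.rel R s)) (by funext σ v; exact h σ v)
  | @eq Γ σ M N =>
    simp only [Str.formula, genericStr_term]
    have h := Cls.lift_mk hT (Subst.one (M.subst (Cls.genSub hT Γ)))
      (Subst.one (N.subst (Cls.genSub hT Γ)))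
    refine (congrArg (fun f => FormCls.pull hT f (FormCls.eq hT [σ])) h).trans ?_
    rw [FormCls.pull_eq]
    -- Over a one-variable context `Eq` is represented by `e ⊗ (x = x')`, because the product of
    -- equations starts from `e`. The unit law removes that factor.
    change FormCls.mk hT (Formula.unit.tensor (.eq _ _)) = _
    rw [← FormCls.tensor_mk, ← FormCls.unit_mk, FormCls.unit_tensor]
    rfl
  | conn c φ ih =>
    exact (congrArg ((classifying hT).conn _ c) (funext ih)).trans (FormCls.conn_mk hT c _)
  | @quant Γ q σ φ ih =>
    refine (congrArg ((classifying hT).quant q _ (Cls.ofSort hT σ)) ih).trans ?_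
    rw [Cls.genSub_cons]
    rfl

/-- The generic structure satisfies exactly the assertions of the theory. -/
theorem genericStr_sat_iff {T : Theory 𝓛 Sg} (hT : IsBaseTheory T) (a : Assertion 𝓛 Sg) :
    (genericStr hT).Sat a ↔ a ∈ T := by
  cases a with
  | @eqn Γ τ M N =>
    obtain ⟨t, ht⟩ := Cls.exists_genSub_comp hT Γ
    change (genericStr hT).term M = (genericStr hT).term N ↔ _
    rw [genericStr_term, genericStr_term]
    -- Equality of the classes of one-term tuples means provable equality of their only component.
    -- In one direction the renaming of variables is undone by `t`; in the other it is an instance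
    -- of substitution.
    refine Quotient.eq.trans ⟨fun h => ?_, fun h σ v => ?_⟩
    · have h1 := hT.subst_eqn (fun σ v => hT.refl (t v)) (h τ .zero)
      change Assertion.eqn ((M.subst _).subst t) ((N.subst _).subst t) ∈ T at h1
      rwa [Term.subst_comp, Term.subst_comp, ht, Term.subst_id, Term.subst_id] at h1
    · cases v with
      | zero => exact hT.subst_eqn (fun σ v => hT.refl _) h
      | succ v => cases v
  | @seq Γ Φ ψ =>
    obtain ⟨t, ht⟩ := Cls.exists_genSub_comp hT Γ
    rw [(genericStr hT).sat_seq_iff (Φ' := Φ.map (·.subst (Cls.genSub hT Γ))) ?_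
      (genericStr_formula hT ψ).symm]
    · exact hT.subst_iff ht
    · rw [List.map_map]
      exact List.map_congr_left fun φ _ => (genericStr_formula hT φ).symm

end FibLogic

/-! ### Soundness and completeness -/

theorem mainTheorem7 (𝓛 : FibLogic.Language.{v}) (L : FibLogic.Logic 𝓛)
    (Sg : FibLogic.Signature.{u}) (T T' : FibLogic.Theory 𝓛 Sg) :
    L.Entails T T' ↔ FibLogic.Models (FibLogic.Logic.classifyingClass.{u, v} L) T T' := by
  constructor
  · rintro h _ ⟨Sg₀, T₀, hT₀, rfl⟩ S hS a ha
    exact S.sat_derivable hT₀ hS (h ha)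
  · intro h a ha
    have hT := L.isTheory_closure T
    -- The hypothesis is tested on a single structure, the generic one over the closure of `T`. It
    -- is a model of `T` because hypotheses are derivable, and what it satisfies lies in that
    -- closure.
    refine (FibLogic.genericStr_sat_iff hT.base a).1 (h _ ⟨Sg, _, hT, rfl⟩ _ ?_ ha)
    exact fun b hb => (FibLogic.genericStr_sat_iff hT.base b).2 (.hyp hb)
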